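/- Conventions. $\mathbb N=\{1,2,\dots\}$; for an infinite set $M\subset\mathbb N$, $[M]$ is the set of infinite subsets of $M$. $X$ is a real Banach space. A weakly null sequence $s=(x_n)_{n\ge 1}$ in $X$ is here always assumed to be normalized ($\|x_n\|=1$ for all $n$) and bimonotone, i.e. $\max\{\|\sum_{i=1}^{n}a_ix_i\|,\ \|\sum_{i=n+1}^{\infty}a_ix_i\|\}\le\|\sum_{i=1}^{\infty}a_ix_i\|$ for all $n$ and all scalars $(a_i)$. For each countable ordinal $\xi$ fix a sequence of ordinals $(\xi_n+1)_{n\ge1}$ associated to $\xi$: $\xi_n+1=\xi$ for all $n$ if $\xi$ is a successor, and $(\xi_n+1)$ strictly increases to $\xi$ if $\xi$ is a limit ordinal. Let $(e_n)$ be the unit vector basis of $\ell_1$. The repeated averages $(\xi_n^M)_{n\ge1}$, for $\xi<\omega_1$ and $M\in[\mathbb N]$, are the finitely supported vectors of $\ell_1$ defined by induction on $\xi$ as follows. If $\xi=0$ and $M=\{m_1<m_2<\cdots\}$, then $\xi_n^M=e_{m_n}$. If $\xi=\zeta+1$, then $\xi_1^M=\frac1{m_1}\sum_{i=1}^{m_1}\zeta_i^M$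 with $m_1=\min M$, and $\xi_{n+1}^M=\frac1{k_n}\sum_{i=1}^{k_n}\zeta_i^{M_n}$, where $M_n=\{m\in M: m>\max\operatorname{supp}\xi_n^M\}$ and $k_n=\min M_n$. If $\xi$ is a limit ordinal, then $\xi_1^M=[\xi_{m_1}+1]_1^M$ and $\xi_{n+1}^M=[\xi_{k_n}+1]_1^{M_n}$, with $m_1$, $M_n$, $k_n$ as before. For $\mu=\sum_n b_ne_n$ put $\mu\cdot s=\sum_n b_nx_n$. Theorem (generalized Elton near unconditionality). Let $s=(x_n)$ be a weakly null sequence (normalized and bimonotone, as above) in a Banach space $X$ and let $\xi$ be a countable ordinal. There exists $M\in[\mathbb N]$ such that for every $\delta\in(0,1]$ there exists a constant $C(\delta)>0$ with the following property: if $L\in[M]$, $n\in\mathbb N$ and $a_1,\dots,a_n$ are scalars in $[-1,1]$, then $$\Bigl\|\sum_{i\in F}a_i\,\xi_i^L\cdot s\Bigr\|\le C(\delta)\max\Bigl\{\delta,\ \Bigl\|\sum_{i=1}^{n}a_i\,\xi_i^L\cdot s\Bigr\|\Bigr\}$$ for all $F\subset\{i\le n:|a_i|\ge\delta\}$. -/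

import Mathlib

open Set Filter Topology

/-- The standing meaning of "weakly null sequence": a sequence `(x_n)`, `n ≥ 1`, that is weakly
null, normalized and bimonotone.  The value `s 0` plays no role; the infinite sums of
the bimonotonicity inequality are written as the sums over `i ≤ N`, with `N` arbitrary. -/
structure IsWeaklyNull {X : Type*} [NormedAddCommGroup X] [NormedSpace ℝ X] (s : ℕ → X) :
    Prop where
  weakly_null : ∀ f : X →L[ℝ] ℝ, Tendsto (fun n => f (s n)) atTop (𝓝 0)
  normalized : ∀ n, 1 ≤ n → ‖s n‖ = 1
  bimonotone : ∀ (a : ℕ → ℝ) (n N : ℕ), n ≤ N →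
    max ‖∑ i ∈ Finset.Icc 1 n, a i • s i‖ ‖∑ i ∈ Finset.Icc (n + 1) N, a i • s i‖ ≤
      ‖∑ i ∈ Finset.Icc 1 N, a i • s i‖

/-- `(ξ_n + 1)`, `n ≥ 1`, where `ξ_n = f n`, is a sequence of ordinals associated to `ξ`: it is
constantly `ξ` if `ξ` is a successor, and strictly increases to `ξ` if `ξ` is a limit. -/
def IsAssociated (ξ : Ordinal.{0}) (f : ℕ → Ordinal.{0}) : Prop :=
  (∀ ζ, ξ = ζ + 1 → ∀ n, 1 ≤ n → f n + 1 = ξ) ∧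
  (Order.IsSuccLimit ξ →
    StrictMonoOn (fun n => f n + 1) (Ici 1) ∧ IsLUB ((fun n => f n + 1) '' Ici 1) ξ)

/-- A choice, for each countable ordinal `ξ`, of a sequence associated to `ξ`. -/
structure AssociatedSequences where
  /-- `seq ξ n` is the ordinal `ξ_n`. -/
  seq : Ordinal.{0} → ℕ → Ordinal.{0}
  isAssociated : ∀ ξ, ξ < Ordinal.omega 1 → IsAssociated ξ (seq ξ)

/-- Given a rule `first` that assigns to each set of positive integers a finitely supported
vector, the sequence `μ_1, μ_2, …` with `μ_1 = first M` and `μ_{n+1} = first M_n`, where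
`M_n = {m ∈ M : m > max supp μ_n}`.  `blockSeq first M n` is `μ_{n+1}`. -/
noncomputable def blockSeq (first : Set ℕ → (ℕ →₀ ℝ)) (M : Set ℕ) : ℕ → (ℕ →₀ ℝ)
  | 0 => first M
  | n + 1 => first {m ∈ M | ∀ j ∈ (blockSeq first M n).support, j < m}

open Classical in
/-- The repeated averages hierarchy: `repeatedAverage A ξ M n` is the vector `ξ_{n+1}^M`
(the terms are numbered from `0`).  In the limit case the condition `h` holds for every countable
`ξ` and every `M` of positive integers; it is there to make the recursion legitimate. -/
noncomputable def repeatedAverage (A : AssociatedSequences) (ξ : Ordinal.{0}) :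
    Set ℕ → ℕ → (ℕ →₀ ℝ) :=
  Ordinal.limitRecOn (motive := fun _ => Set ℕ → ℕ → (ℕ →₀ ℝ)) ξ
    (fun M n => Finsupp.single (Nat.nth (· ∈ M) n) 1)
    (fun _ avg => blockSeq fun M =>
      ((sInf M : ℕ) : ℝ)⁻¹ • ∑ i ∈ Finset.range (sInf M), avg M i)
    (fun ξ _ avg => blockSeq fun M =>
      if h : A.seq ξ (sInf M) + 1 < ξ then avg (A.seq ξ (sInf M) + 1) h M 0 else 0)

/-- `μ · s = ∑ a_n x_n` for `μ = ∑ a_n e_n` of finite support and `s = (x_n)`. -/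
noncomputable def dotSeq {X : Type*} [NormedAddCommGroup X] [NormedSpace ℝ X]
    (μ : ℕ →₀ ℝ) (s : ℕ → X) : X :=
  μ.sum fun n c => c • s n

/-! # Near unconditionality of repeated averages

Fix a functional `f` of norm one that norms `∑_{i ∈ F} a_i y_i`, where `y_i = ξ_i^L · s`. Up to a
factor `2` and a sign, only the blocks `i ∈ F` with `a_i > 0` and `f(y_i) ≥ 0` count; on these
`a_i ≥ δ`, so it is enough to find `g` of norm at most one that is still nonnegative on them (up to
a small error), whose sum over them is still a fixed fraction of that of `f`, and that is nearly
zero at all `x_l` with `l` in the support of any other block. Then `g(∑ a_i y_i)` is at least `δ`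
times that sum, up to an absolute constant, which `max δ ‖·‖` absorbs at the cost of a constant that
depends on `δ` only. In particular `M` does not depend on `δ`.

The coordinates `l` of the other blocks are removed one at a time, in increasing order. For a fixed
finite set of earlier coordinates and a fixed threshold `s`, call `l` *bad* for a set `L` of later
integers if for some `n` there are functionals that are nonnegative on the first `n` blocks of `L`
with sum at least `s` there, but all of these are at least `ε` in absolute value at `l`. This is an
open condition on `{l} ∪ L`, so that Ramsey's theorem for open sets (`exists_homogeneous_of_open`)
makes all or none of the `{l} ∪ L` inside some infinite set bad. If all are bad, let `l` run over the
first `k` points, all followed by the same `L`, and take a functional for the smallest `n` that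
occurs; cut off beyond its `n` blocks, which bimonotonicity permits, it serves all the larger `n` as
well (`IsDualBall.exists_isLargeOn_of_le`) and is therefore large at all `k` points. A weak* limit
over `k` contradicts weak nullity (`IsDualBall.exists_forall_abs_lt`). So none are bad
(`IsDualBall.exists_subset_small_at_in_cell`); finitely many cells and thresholds
(`IsDualBall.exists_subset_canRemove`) and a fusion (`IsDualBall.exists_isRemovable`) give `M`, and
an induction on the number of blocks adds up the errors
(`IsRemovable.exists_le_sum_mul_pairing`). At the point of rank `k` in `M` only thresholds up to
`k + 1` are dealt with; this suffices, since the first `⌊T / 2⌋` blocks contribute at most half of a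
sum `T` and can be dropped, after which all remaining points have rank at least `⌊T / 2⌋`.

Of the repeated averages only this is used: the first average of `L` is a convex combination
supported by an initial segment of `L`, and depends on that segment only (`IsAveraging`). Hence any
subfamily of the blocks of `L` consists of the first blocks of a subset of `L`
(`IsAveraging.exists_blockSeq_subfamily`), which is what makes the removal of whole blocks possible.
-/

/-! ### Ramsey's theorem for open sets of infinite sets of integers -/

/-- Fusion: a hereditary property of pairs (finite set, infinite set) that can be reached by
shrinking the infinite set can be reached for all finite subsets of one infinite set. -/
theorem exists_infinite_fusion (R : Finset ℕ → Set ℕ → Prop)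
    (mono : ∀ P A B, B ⊆ A → R P A → R P B)
    (shrink : ∀ P A, A.Infinite → ∃ B ⊆ A, B.Infinite ∧ R P B)
    (A : Set ℕ) (hA : A.Infinite) :
    ∃ B ⊆ A, B.Infinite ∧ ∀ P : Finset ℕ, (P : Set ℕ) ⊆ B → R P {b ∈ B | ∀ x ∈ P, x < b} := by
  classical
  have shrinkAll : ∀ (T : Finset (Finset ℕ)) (A : Set ℕ), A.Infinite →
      ∃ B ⊆ A, B.Infinite ∧ ∀ P ∈ T, R P B := by
    intro T
    induction T using Finset.induction_on with
    | empty => exact fun A hA => ⟨A, subset_rfl, hA, by simp⟩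
    | insert P T _ ih =>
      intro A hA
      obtain ⟨B, hBA, hB, h⟩ := ih A hA
      obtain ⟨C, hCB, hC, hP⟩ := shrink P B hB
      refine ⟨C, hCB.trans hBA, hC, fun Q hQ => ?_⟩
      rcases Finset.mem_insert.1 hQ with rfl | hQ
      · exact hP
      · exact mono _ _ _ hCB (h Q hQ)
  have step : ∀ q : Finset ℕ × {A : Set ℕ // A.Infinite}, ∃ C : {A : Set ℕ // A.Infinite},
      C.1 ⊆ q.2.1 ∧ (∀ c ∈ C.1, sInf q.2.1 < c) ∧
        ∀ P ⊆ insert (sInf q.2.1) q.1, R P C.1 := by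
    rintro ⟨Q, A, hA⟩
    have hA' : (A \ Iic (sInf A)).Infinite := hA.sdiff (finite_Iic _)
    obtain ⟨C, hCA, hC, h⟩ := shrinkAll (insert (sInf A) Q).powerset _ hA'
    exact ⟨⟨C, hC⟩, hCA.trans sdiff_subset, fun c hc => not_le.1 (hCA hc).2,
      fun P hP => h P (Finset.mem_powerset.2 hP)⟩
  choose nxt hsub hlt hR using step
  obtain ⟨A₀, hA₀A, hA₀, hR₀⟩ := shrink ∅ A hA
  let st : ℕ → Finset ℕ × {A : Set ℕ // A.Infinite} := fun k =>
    Nat.rec (∅, ⟨A₀, hA₀⟩) (fun _ q => (insert (sInf q.2.1) q.1, nxt q)) k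
  have st_succ : ∀ k, st (k + 1) = (insert (sInf (st k).2.1) (st k).1, nxt (st k)) :=
    fun k => rfl
  let m : ℕ → ℕ := fun k => sInf (st k).2.1
  have hm : ∀ k, m k ∈ (st k).2.1 := fun k => Nat.sInf_mem (st k).2.2.nonempty
  have anti : Antitone fun k => (st k).2.1 := by
    refine antitone_nat_of_succ_le fun k => ?_
    rw [st_succ]
    exact hsub _
  have mlt : StrictMono m := by
    refine strictMono_nat_of_lt_succ fun k => ?_
    have := hm (k + 1)
    rw [st_succ] at this
    exact hlt _ _ this
  have hfin : ∀ k i, i < k → m i ∈ (st k).1 := by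
    intro k
    induction k with
    | zero => intro i hi; omega
    | succ k ih =>
      intro i hi
      rw [st_succ]
      rcases Nat.lt_succ_iff_lt_or_eq.1 hi with h | rfl
      · exact Finset.mem_insert_of_mem (ih i h)
      · exact Finset.mem_insert_self _ _
  refine ⟨range m, ?_, infinite_range_of_injective mlt.injective, fun P hP => ?_⟩
  · rintro _ ⟨k, rfl⟩
    exact hA₀A (anti (Nat.zero_le k) (hm k))
  · rcases P.eq_empty_or_nonempty with rfl | hne
    · refine mono _ _ _ ?_ hR₀
      rintro _ ⟨⟨k, rfl⟩, -⟩
      exact anti (Nat.zero_le k) (hm k)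
    · obtain ⟨k, hk⟩ := hP (P.max'_mem hne)
      have hPk : P ⊆ insert (sInf (st k).2.1) (st k).1 := by
        intro x hx
        obtain ⟨i, rfl⟩ := hP hx
        have : m i ≤ m k := hk ▸ P.le_max' _ hx
        rcases (mlt.le_iff_le.1 this).lt_or_eq with h | rfl
        · exact Finset.mem_insert_of_mem (hfin k i h)
        · exact Finset.mem_insert_self _ _
      refine mono _ _ _ ?_ (hR (st k) P hPk)
      rintro _ ⟨⟨i, rfl⟩, hi⟩
      have : m k < m i := hk ▸ hi _ (P.max'_mem hne)
      have := anti (Nat.succ_le_of_lt (mlt.lt_iff_lt.1 this)) (hm i)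
      simpa [st_succ] using this

/-- Nash-Williams: a property of infinite sets of integers that, where it holds, is guaranteed
by an initial segment, holds for all or for none of the infinite subsets of some infinite set. -/
theorem exists_homogeneous_of_open (𝒰 : Set ℕ → Prop)
    (hopen : ∀ L : Set ℕ, L.Infinite → 𝒰 L → ∃ N, ∀ L' : Set ℕ, L'.Infinite →
      (∀ m ≤ N, m ∈ L' ↔ m ∈ L) → 𝒰 L')
    (A : Set ℕ) (hA : A.Infinite) :
    ∃ B ⊆ A, B.Infinite ∧
      ((∀ L ⊆ B, L.Infinite → 𝒰 L) ∨ ∀ L ⊆ B, L.Infinite → ¬ 𝒰 L) := by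
  classical
  -- `acc P A`: every infinite set with initial segment `P` and remainder in `A` has the property.
  let acc : Finset ℕ → Set ℕ → Prop := fun P A =>
    ∀ L ⊆ A, L.Infinite → (∀ p ∈ P, ∀ l ∈ L, p < l) → 𝒰 (↑P ∪ L)
  have acc_mono : ∀ P A B, B ⊆ A → acc P A → acc P B :=
    fun P A B h hacc L hL => hacc L (hL.trans h)
  let rej : Finset ℕ → Set ℕ → Prop := fun P A => ∀ B ⊆ A, B.Infinite → ¬ acc P B
  obtain ⟨B, hBA, hB, hdec⟩ := exists_infinite_fusion (fun P A => acc P A ∨ rej P A)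
    (fun P A B h => Or.imp (acc_mono P A B h) fun hr C hC => hr C (hC.trans h))
    (fun P A hA => by
      by_cases h : ∃ B ⊆ A, B.Infinite ∧ acc P B
      · obtain ⟨B, h1, h2, h3⟩ := h
        exact ⟨B, h1, h2, Or.inl h3⟩
      · push Not at h
        exact ⟨A, subset_rfl, hA, Or.inr h⟩) A hA
  have above : ∀ (P : Finset ℕ) (C : Set ℕ), C.Infinite → {b ∈ C | ∀ x ∈ P, x < b}.Infinite := by
    intro P C hC
    refine (hC.sdiff (finite_Iic (P.sup id))).mono fun b hb => ⟨hb.1, fun x hx => ?_⟩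
    exact (Finset.le_sup (f := id) hx).trans_lt (not_le.1 hb.2)
  have acc_above : ∀ P C, acc P {b ∈ C | ∀ x ∈ P, x < b} → acc P C :=
    fun P C h L hL hLi hPL => h L (fun l hl => ⟨hL hl, fun x hx => hPL x hx l hl⟩) hLi hPL
  have rej_above : ∀ P C, rej P {b ∈ C | ∀ x ∈ P, x < b} → rej P C :=
    fun P C h D hD hDi hacc => h _ (fun b hb => ⟨hD hb.1, hb.2⟩) (above P D hDi)
      (acc_mono _ _ _ (sep_subset _ _) hacc)
  have hdec' : ∀ P : Finset ℕ, (P : Set ℕ) ⊆ B → acc P B ∨ rej P B :=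
    fun P hP => (hdec P hP).imp (acc_above P B) (rej_above P B)
  rcases hdec' ∅ (by simp) with h0 | h0
  · exact ⟨B, hBA, hB, Or.inl fun L hL hLi => by simpa using h0 L hL hLi (by simp)⟩
  · obtain ⟨C, hCB, hC, hrej⟩ := exists_infinite_fusion
      (fun P A => (P : Set ℕ) ⊆ B → rej P B → ∀ n ∈ A, n ∈ B → (∀ x ∈ P, x < n) →
        rej (insert n P) B)
      (fun P A D h hR h1 h2 n hn => hR h1 h2 n (h hn))
      (fun P D hD => by
        by_cases hP : (P : Set ℕ) ⊆ B ∧ rej P B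
        swap
        · exact ⟨D, subset_rfl, hD, fun h1 h2 => absurd ⟨h1, h2⟩ hP⟩
        let G : Set ℕ := {n | n ∈ D ∧ n ∈ B ∧ (∀ x ∈ P, x < n) ∧ ¬ rej (insert n P) B}
        have hG : G.Finite := by
          -- Otherwise the one-point extensions of `P` that are accepted would make up an
          -- infinite set accepting `P`.
          by_contra hG
          refine hP.2 G (fun n hn => hn.2.1) hG fun L hL hLi hPL => ?_
          have hl := Nat.sInf_mem hLi.nonempty
          obtain ⟨-, hlB, -, hlr⟩ := hL hl
          have hacc : acc (insert (sInf L) P) B :=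
            (hdec' _ (by
              intro x hx
              rcases Finset.mem_insert.1 hx with rfl | hx
              · exact hlB
              · exact hP.1 hx)).resolve_right hlr
          have := hacc (L \ {sInf L}) (fun x hx => (hL hx.1).2.1)
            (hLi.sdiff (finite_singleton _)) (by
              intro p hp l hl'
              rcases Finset.mem_insert.1 hp with rfl | hp
              · exact lt_of_le_of_ne (Nat.sInf_le hl'.1) fun h => hl'.2 h.symm
              · exact hPL p hp l hl'.1)
          convert this using 1
          ext x
          by_cases hx : x = sInf L
          · simp [hx, hl]
          · simp [hx]
        refine ⟨D \ G, sdiff_subset, hD.sdiff hG, fun _ _ n hn hnB hPn => ?_⟩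
        by_contra hcon
        exact hn.2 ⟨hn.1, hnB, hPn, hcon⟩) B hB
    have hall : ∀ P : Finset ℕ, (P : Set ℕ) ⊆ C → rej P B := by
      intro P
      induction P using Finset.induction_on_max with
      | empty => exact fun _ => h0
      | insert a P ha ih =>
        intro hP
        rw [Finset.coe_insert, insert_subset_iff] at hP
        exact hrej P hP.2 (hP.2.trans hCB) (ih hP.2) a ⟨hP.1, ha⟩ (hCB hP.1) ha
    refine ⟨C, hCB.trans hBA, hC, Or.inr fun L hL hLi hU => ?_⟩
    obtain ⟨N, hN⟩ := hopen L hLi hU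
    obtain ⟨l, hl, hNl⟩ := hLi.exists_gt N
    have hfin : (L ∩ Iic l).Finite := (finite_Iic l).subset inter_subset_right
    have hcoe : (hfin.toFinset : Set ℕ) = L ∩ Iic l := hfin.coe_toFinset
    refine hall hfin.toFinset (by rw [hcoe]; exact inter_subset_left.trans hL) B subset_rfl hB
      fun L' _ hL'i hlt => ?_
    refine hN _ (hL'i.mono subset_union_right) fun m hm => ?_
    have hmL' : m ∉ L' := fun h => by
      have := hlt l (by simp [hl]) m h
      omega
    rw [hcoe]
    simp only [mem_union, mem_inter_iff, mem_Iic, hmL', or_false]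
    exact ⟨fun h => h.1, fun h => ⟨h, by omega⟩⟩

/-! ### Averaging rules and their block sequences -/

/-- A rule that assigns to every infinite set `L` of positive integers a convex combination of unit
vectors whose support is an initial segment of `L`, in such a way that the vector depends only on
that initial segment. -/
structure IsAveraging (first : Set ℕ → (ℕ →₀ ℝ)) : Prop where
  nonneg : ∀ L : Set ℕ, L.Infinite → L ⊆ Ici 1 → ∀ j, 0 ≤ first L j
  sum_eq_one : ∀ L : Set ℕ, L.Infinite → L ⊆ Ici 1 → ((first L).sum fun _ c => c) = 1
  support_subset : ∀ L : Set ℕ, L.Infinite → L ⊆ Ici 1 → ∀ j ∈ (first L).support, j ∈ L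
  initial : ∀ L : Set ℕ, L.Infinite → L ⊆ Ici 1 →
    ∀ j ∈ (first L).support, ∀ m ∈ L, m ≤ j → m ∈ (first L).support
  congr : ∀ L : Set ℕ, L.Infinite → L ⊆ Ici 1 → ∀ L' : Set ℕ, L'.Infinite → L' ⊆ Ici 1 →
    (∀ j ∈ (first L).support, ∀ m ≤ j, m ∈ L' ↔ m ∈ L) → first L' = first L

/-- The part of `L` beyond the support of the first block. -/
def afterBlock (first : Set ℕ → (ℕ →₀ ℝ)) (L : Set ℕ) : Set ℕ :=
  {m ∈ L | ∀ j ∈ (first L).support, j < m}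

theorem afterBlock_subset (first : Set ℕ → (ℕ →₀ ℝ)) (L : Set ℕ) : afterBlock first L ⊆ L :=
  sep_subset _ _

theorem infinite_sep_forall_lt {L : Set ℕ} (hL : L.Infinite) (P : Finset ℕ) :
    {m ∈ L | ∀ j ∈ P, j < m}.Infinite :=
  (hL.sdiff (finite_Iic (P.sup id))).mono fun _ hb =>
    ⟨hb.1, fun _ hx => (Finset.le_sup (f := id) hx).trans_lt (not_le.1 hb.2)⟩

theorem infinite_afterBlock (first : Set ℕ → (ℕ →₀ ℝ)) {L : Set ℕ} (hL : L.Infinite) :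
    (afterBlock first L).Infinite :=
  infinite_sep_forall_lt hL _

namespace IsAveraging

variable {first : Set ℕ → (ℕ →₀ ℝ)}

theorem support_nonempty (h : IsAveraging first) {L : Set ℕ} (hL : L.Infinite)
    (hp : L ⊆ Ici 1) : (first L).support.Nonempty := by
  by_contra hne
  have h1 := h.sum_eq_one L hL hp
  rw [Finset.not_nonempty_iff_eq_empty] at hne
  simp [Finsupp.sum, hne] at h1

theorem sInf_mem_support (h : IsAveraging first) {L : Set ℕ} (hL : L.Infinite)
    (hp : L ⊆ Ici 1) : sInf L ∈ (first L).support := by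
  obtain ⟨j, hj⟩ := h.support_nonempty hL hp
  exact h.initial L hL hp j hj _ (Nat.sInf_mem hL.nonempty)
    (Nat.sInf_le (h.support_subset L hL hp j hj))

theorem mem_support_or_mem_afterBlock (h : IsAveraging first) {L : Set ℕ} (hL : L.Infinite)
    (hp : L ⊆ Ici 1) {m : ℕ} (hm : m ∈ L) : m ∈ (first L).support ∨ m ∈ afterBlock first L := by
  by_cases hms : ∃ j ∈ (first L).support, m ≤ j
  · obtain ⟨j, hj, hmj⟩ := hms
    exact Or.inl (h.initial L hL hp j hj m hm hmj)
  · push Not at hms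
    exact Or.inr ⟨hm, hms⟩

theorem blockSeq_spec (h : IsAveraging first) (n : ℕ) : ∀ {L : Set ℕ}, L.Infinite → L ⊆ Ici 1 →
    blockSeq first L (n + 1) = blockSeq first (afterBlock first L) n ∧
      ∀ j ∈ (blockSeq first L n).support, j ∈ L := by
  induction n with
  | zero => exact fun {L} hL hp => ⟨rfl, h.support_subset L hL hp⟩
  | succ n ih =>
    intro L hL hp
    have hA := infinite_afterBlock first hL
    have hAp := (afterBlock_subset first L).trans hp
    have h1 : ∀ j ∈ (blockSeq first L (n + 1)).support, j ∈ afterBlock first L := by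
      rw [(ih hL hp).1]
      exact (ih hA hAp).2
    refine ⟨?_, fun j hj => (h1 j hj).1⟩
    have hne : (blockSeq first L (n + 1)).support.Nonempty :=
      h.support_nonempty (infinite_sep_forall_lt hL _) ((sep_subset _ _).trans hp)
    change first _ = first _
    congr 1
    ext m
    rw [← (ih hL hp).1]
    refine ⟨fun hm => ⟨⟨hm.1, fun j hj => ?_⟩, hm.2⟩, fun hm => ⟨hm.1.1, hm.2⟩⟩
    obtain ⟨i, hi⟩ := hne
    exact ((h1 i hi).2 j hj).trans (hm.2 i hi)

theorem blockSeq_succ (h : IsAveraging first) {L : Set ℕ} (hL : L.Infinite) (hp : L ⊆ Ici 1)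
    (n : ℕ) : blockSeq first L (n + 1) = blockSeq first (afterBlock first L) n :=
  (h.blockSeq_spec n hL hp).1

theorem blockSeq_support_subset (h : IsAveraging first) {L : Set ℕ} (hL : L.Infinite)
    (hp : L ⊆ Ici 1) (n : ℕ) : ∀ j ∈ (blockSeq first L n).support, j ∈ L :=
  (h.blockSeq_spec n hL hp).2

/-- Every term of a block sequence is the first block of some set. -/
theorem exists_blockSeq_eq_first (first : Set ℕ → (ℕ →₀ ℝ)) {L : Set ℕ} (hL : L.Infinite)
    (n : ℕ) : ∃ L' ⊆ L, L'.Infinite ∧ blockSeq first L n = first L' := by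
  cases n with
  | zero => exact ⟨L, subset_rfl, hL, rfl⟩
  | succ n => exact ⟨_, sep_subset _ _, infinite_sep_forall_lt hL _, rfl⟩

theorem blockSeq_nonneg (h : IsAveraging first) {L : Set ℕ} (hL : L.Infinite) (hp : L ⊆ Ici 1)
    (n j : ℕ) : 0 ≤ blockSeq first L n j := by
  obtain ⟨L', hL'L, hL', he⟩ := exists_blockSeq_eq_first first hL n
  exact he ▸ h.nonneg L' hL' (hL'L.trans hp) j

theorem blockSeq_sum_eq_one (h : IsAveraging first) {L : Set ℕ} (hL : L.Infinite)
    (hp : L ⊆ Ici 1) (n : ℕ) : ((blockSeq first L n).sum fun _ c => c) = 1 := by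
  obtain ⟨L', hL'L, hL', he⟩ := exists_blockSeq_eq_first first hL n
  exact he ▸ h.sum_eq_one L' hL' (hL'L.trans hp)

theorem blockSeq_support_nonempty (h : IsAveraging first) {L : Set ℕ} (hL : L.Infinite)
    (hp : L ⊆ Ici 1) (n : ℕ) : (blockSeq first L n).support.Nonempty := by
  obtain ⟨L', hL'L, hL', he⟩ := exists_blockSeq_eq_first first hL n
  exact he ▸ h.support_nonempty hL' (hL'L.trans hp)

theorem blockSeq_lt (h : IsAveraging first) (i : ℕ) : ∀ {L : Set ℕ}, L.Infinite → L ⊆ Ici 1 →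
    ∀ k, i < k → ∀ j ∈ (blockSeq first L i).support, ∀ m ∈ (blockSeq first L k).support,
      j < m := by
  induction i with
  | zero =>
    intro L hL hp k hk j hj m hm
    obtain ⟨k, rfl⟩ := Nat.exists_eq_succ_of_ne_zero hk.ne'
    rw [h.blockSeq_succ hL hp] at hm
    exact (h.blockSeq_support_subset (infinite_afterBlock first hL)
      ((afterBlock_subset first L).trans hp) k m hm).2 j hj
  | succ i ih =>
    intro L hL hp k hk
    obtain ⟨k, rfl⟩ := Nat.exists_eq_succ_of_ne_zero (Nat.ne_zero_of_lt hk)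
    rw [h.blockSeq_succ hL hp, h.blockSeq_succ hL hp]
    exact ih (infinite_afterBlock first hL) ((afterBlock_subset first L).trans hp) k
      (Nat.succ_lt_succ_iff.1 hk)

/-- The supports of the blocks exhaust initial segments. -/
theorem blockSeq_initial (h : IsAveraging first) (i : ℕ) : ∀ {L : Set ℕ}, L.Infinite →
    L ⊆ Ici 1 → ∀ j ∈ (blockSeq first L i).support, ∀ m ∈ L, m ≤ j →
      ∃ k ≤ i, m ∈ (blockSeq first L k).support := by
  induction i with
  | zero => exact fun {L} hL hp j hj m hm hmj => ⟨0, le_rfl, h.initial L hL hp j hj m hm hmj⟩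
  | succ i ih =>
    intro L hL hp j hj m hm hmj
    rcases h.mem_support_or_mem_afterBlock hL hp hm with hm | hm
    · exact ⟨0, Nat.zero_le _, hm⟩
    · rw [h.blockSeq_succ hL hp] at hj
      obtain ⟨k, hk, hmk⟩ := ih (infinite_afterBlock first hL)
        ((afterBlock_subset first L).trans hp) j hj m hm hmj
      exact ⟨k + 1, Nat.succ_le_succ hk, by rwa [h.blockSeq_succ hL hp]⟩

/-- The first `n` blocks depend only on the initial segment that they fill. -/
theorem blockSeq_congr (h : IsAveraging first) (n : ℕ) : ∀ {L : Set ℕ}, L.Infinite →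
    L ⊆ Ici 1 → ∀ {L' : Set ℕ}, L'.Infinite → L' ⊆ Ici 1 →
    (∀ i < n, ∀ j ∈ (blockSeq first L i).support, ∀ m ≤ j, m ∈ L' ↔ m ∈ L) →
      ∀ i < n, blockSeq first L' i = blockSeq first L i := by
  induction n with
  | zero => intro L _ _ L' _ _ _ i hi; omega
  | succ n ih =>
    intro L hL hp L' hL' hp' hag i hi
    have h0 : first L' = first L := h.congr L hL hp L' hL' hp' (hag 0 (Nat.succ_pos n))
    cases i with
    | zero => exact h0
    | succ i =>
      rw [h.blockSeq_succ hL hp, h.blockSeq_succ hL' hp']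
      refine ih (infinite_afterBlock first hL) ((afterBlock_subset first L).trans hp)
        (infinite_afterBlock first hL') ((afterBlock_subset first L').trans hp')
        (fun i hi j hj m hm => ?_) i (Nat.succ_lt_succ_iff.1 hi)
      have := hag (i + 1) (Nat.succ_lt_succ hi) j (by rwa [h.blockSeq_succ hL hp]) m hm
      simp only [afterBlock, mem_ofPred_eq, this, h0]

/-- A subfamily of the first `n` blocks of `L` consists of the first blocks of a subset of `L`. -/
theorem exists_blockSeq_subfamily (h : IsAveraging first) (n : ℕ) : ∀ {L : Set ℕ}, L.Infinite →
    L ⊆ Ici 1 → ∀ F : ℕ → Prop, ∃ L' ⊆ L, L'.Infinite ∧ ∃ r : ℕ,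
      (∀ j < r, ∃ i < n, F i ∧ blockSeq first L' j = blockSeq first L i) ∧
      (∀ i < n, F i → ∃ j < r, blockSeq first L' j = blockSeq first L i) ∧
      ∀ g : (ℕ →₀ ℝ) → ℝ, ∀ [DecidablePred F],
        ∑ j ∈ Finset.range r, g (blockSeq first L' j) =
          ∑ i ∈ Finset.range n, if F i then g (blockSeq first L i) else 0 := by
  induction n with
  | zero => exact fun {L} hL hp F => ⟨L, subset_rfl, hL, 0, by simp⟩
  | succ n ih =>
    intro L hL hp F
    obtain ⟨L₁, hL₁A, hL₁, r, h1, h2, h3⟩ := ih (infinite_afterBlock first hL)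
      ((afterBlock_subset first L).trans hp) fun i => F (i + 1)
    simp only [← h.blockSeq_succ hL hp] at h1 h2 h3
    by_cases hF : F 0
    · have hsub : (↑(first L).support ∪ L₁ : Set ℕ) ⊆ L :=
        union_subset (h.support_subset L hL hp) (hL₁A.trans (afterBlock_subset first L))
      have hinf : (↑(first L).support ∪ L₁ : Set ℕ).Infinite := hL₁.mono subset_union_right
      have h0 : first (↑(first L).support ∪ L₁) = first L := by
        refine h.congr L hL hp _ hinf (hsub.trans hp) fun j hj m hm => ⟨fun h => hsub h, fun h' => ?_⟩
        exact Or.inl (h.initial L hL hp j hj m h' hm)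
      have hafter : afterBlock first (↑(first L).support ∪ L₁) = L₁ := by
        ext m
        simp only [afterBlock, mem_ofPred_eq, h0]
        constructor
        · rintro ⟨hm | hm, hlt⟩
          · exact absurd (hlt m hm) (lt_irrefl m)
          · exact hm
        · exact fun hm => ⟨Or.inr hm, (hL₁A hm).2⟩
      have hs : ∀ j, blockSeq first (↑(first L).support ∪ L₁) (j + 1) = blockSeq first L₁ j := by
        intro j
        rw [h.blockSeq_succ hinf (hsub.trans hp), hafter]
      refine ⟨_, hsub, hinf, r + 1, fun j hj => ?_, fun i hi hFi => ?_, fun g _ => ?_⟩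
      · cases j with
        | zero => exact ⟨0, Nat.succ_pos n, hF, h0⟩
        | succ j =>
          obtain ⟨i, hi, hFi, he⟩ := h1 j (Nat.succ_lt_succ_iff.1 hj)
          exact ⟨i + 1, Nat.succ_lt_succ hi, hFi, (hs j).trans he⟩
      · cases i with
        | zero => exact ⟨0, Nat.succ_pos r, h0⟩
        | succ i =>
          obtain ⟨j, hj, he⟩ := h2 i (Nat.succ_lt_succ_iff.1 hi) hFi
          exact ⟨j + 1, Nat.succ_lt_succ hj, (hs j).trans he⟩
      · rw [Finset.sum_range_succ', Finset.sum_range_succ', if_pos hF, ← h3 g]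
        simp only [hs]
        congr 2
    · refine ⟨L₁, hL₁A.trans (afterBlock_subset first L), hL₁, r, fun j hj => ?_,
        fun i hi hFi => ?_, fun g _ => ?_⟩
      · obtain ⟨i, hi, hFi, he⟩ := h1 j hj
        exact ⟨i + 1, Nat.succ_lt_succ hi, hFi, he⟩
      · cases i with
        | zero => exact absurd hFi hF
        | succ i => exact h2 i (Nat.succ_lt_succ_iff.1 hi) hFi
      · rw [Finset.sum_range_succ', if_neg hF, add_zero, ← h3 g]

/-! ### The repeated averages are block sequences of averaging rules -/

theorem of_eqOn (h : IsAveraging first) {first' : Set ℕ → (ℕ →₀ ℝ)}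
    (he : ∀ L : Set ℕ, L.Infinite → L ⊆ Ici 1 → first' L = first L) : IsAveraging first' where
  nonneg L hL hp := he L hL hp ▸ h.nonneg L hL hp
  sum_eq_one L hL hp := he L hL hp ▸ h.sum_eq_one L hL hp
  support_subset L hL hp := he L hL hp ▸ h.support_subset L hL hp
  initial L hL hp := he L hL hp ▸ h.initial L hL hp
  congr L hL hp L' hL' hp' := by
    rw [he L hL hp, he L' hL' hp']
    exact h.congr L hL hp L' hL' hp'

theorem single_sInf : IsAveraging fun M => Finsupp.single (sInf M) 1 where
  nonneg L hL hp j := by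
    rw [Finsupp.single_apply]
    split_ifs <;> norm_num
  sum_eq_one L hL hp := by simp
  support_subset L hL hp j hj := by
    obtain rfl : j = sInf L := by simpa using Finsupp.support_single_subset hj
    exact Nat.sInf_mem hL.nonempty
  initial L hL hp j hj m hm hmj := by
    obtain rfl : j = sInf L := by simpa using Finsupp.support_single_subset hj
    rwa [le_antisymm hmj (Nat.sInf_le hm)]
  congr L hL hp L' hL' hp' hag := by
    have h1 := hag (sInf L) (by simp)
    have h2 : sInf L' ≤ sInf L := Nat.sInf_le ((h1 _ le_rfl).2 (Nat.sInf_mem hL.nonempty))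
    have h3 : sInf L ≤ sInf L' := Nat.sInf_le ((h1 _ h2).1 (Nat.sInf_mem hL'.nonempty))
    rw [le_antisymm h2 h3]

theorem sInf_congr (h : IsAveraging first) {L : Set ℕ} (hL : L.Infinite) (hp : L ⊆ Ici 1)
    {L' : Set ℕ} (hL' : L'.Infinite)
    (hag : ∀ j ∈ (first L).support, ∀ m ≤ j, m ∈ L' ↔ m ∈ L) : sInf L' = sInf L := by
  have h1 := hag (sInf L) (h.sInf_mem_support hL hp)
  have h2 : sInf L' ≤ sInf L := Nat.sInf_le ((h1 _ le_rfl).2 (Nat.sInf_mem hL.nonempty))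
  exact le_antisymm h2 (Nat.sInf_le ((h1 _ h2).1 (Nat.sInf_mem hL'.nonempty)))

/-- The successor step of the hierarchy. -/
theorem average (h : IsAveraging first) : IsAveraging fun M =>
    ((sInf M : ℕ) : ℝ)⁻¹ • ∑ i ∈ Finset.range (sInf M), blockSeq first M i := by
  have hpos : ∀ L : Set ℕ, L.Infinite → L ⊆ Ici 1 → 0 < sInf L := fun L hL hp =>
    hp (Nat.sInf_mem hL.nonempty)
  have hsupp : ∀ L : Set ℕ, L.Infinite → L ⊆ Ici 1 → ∀ j,
      j ∈ (((sInf L : ℕ) : ℝ)⁻¹ • ∑ i ∈ Finset.range (sInf L), blockSeq first L i).support ↔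
        ∃ i < sInf L, j ∈ (blockSeq first L i).support := by
    intro L hL hp j
    have h0 : ((sInf L : ℕ) : ℝ) ≠ 0 := Nat.cast_ne_zero.2 (hpos L hL hp).ne'
    rw [Finsupp.mem_support_iff, Finsupp.smul_apply, smul_eq_mul, mul_ne_zero_iff,
      Finsupp.finsetSum_apply, ne_eq, ne_eq, Finset.sum_eq_zero_iff_of_nonneg
        fun i _ => h.blockSeq_nonneg hL hp i j]
    simp [h0]
  refine ⟨fun L hL hp j => ?_, fun L hL hp => ?_, fun L hL hp j hj => ?_,
    fun L hL hp j hj m hm hmj => ?_, fun L hL hp L' hL' hp' hag => ?_⟩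
  · rw [Finsupp.smul_apply, smul_eq_mul, Finsupp.finsetSum_apply]
    exact mul_nonneg (by positivity) (Finset.sum_nonneg fun i _ => h.blockSeq_nonneg hL hp i j)
  · have hlin : ∀ μ : ℕ →₀ ℝ, (μ.sum fun _ c => c) = Finsupp.linearCombination ℝ (fun _ => (1 : ℝ)) μ :=
      fun μ => by simp [Finsupp.linearCombination_apply]
    have h0 : ((sInf L : ℕ) : ℝ) ≠ 0 := Nat.cast_ne_zero.2 (hpos L hL hp).ne'
    rw [hlin, map_smul, map_sum]
    simp only [← hlin, h.blockSeq_sum_eq_one hL hp]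
    simp [h0]
  · obtain ⟨i, _, hj⟩ := (hsupp L hL hp j).1 hj
    exact h.blockSeq_support_subset hL hp i j hj
  · obtain ⟨i, hi, hj⟩ := (hsupp L hL hp j).1 hj
    obtain ⟨k, hk, hmk⟩ := h.blockSeq_initial i hL hp j hj m hm hmj
    exact (hsupp L hL hp m).2 ⟨k, hk.trans_lt hi, hmk⟩
  · have hag' : ∀ i < sInf L, ∀ j ∈ (blockSeq first L i).support, ∀ m ≤ j, m ∈ L' ↔ m ∈ L :=
      fun i hi j hj => hag j ((hsupp L hL hp j).2 ⟨i, hi, hj⟩)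
    have hinf : sInf L' = sInf L := h.sInf_congr hL hp hL' (hag' 0 (hpos L hL hp))
    simp only [hinf]
    congr 1
    exact Finset.sum_congr rfl fun i hi =>
      h.blockSeq_congr _ hL hp hL' hp' hag' i (Finset.mem_range.1 hi)

/-- The limit step of the hierarchy: the rule to be applied depends on `min M`. -/
theorem diagonal {G : ℕ → Set ℕ → (ℕ →₀ ℝ)} (h : ∀ m, 1 ≤ m → IsAveraging (G m)) :
    IsAveraging fun M => G (sInf M) M := by
  have hG : ∀ L : Set ℕ, L.Infinite → L ⊆ Ici 1 → IsAveraging (G (sInf L)) := fun L hL hp =>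
    h _ (hp (Nat.sInf_mem hL.nonempty))
  refine ⟨fun L hL hp => (hG L hL hp).nonneg L hL hp, fun L hL hp => (hG L hL hp).sum_eq_one L hL hp,
    fun L hL hp => (hG L hL hp).support_subset L hL hp,
    fun L hL hp => (hG L hL hp).initial L hL hp, fun L hL hp L' hL' hp' hag => ?_⟩
  simp only [(hG L hL hp).sInf_congr hL hp hL' hag]
  exact (hG L hL hp).congr L hL hp L' hL' hp' hag

end IsAveraging

theorem blockSeq_single_sInf {M : Set ℕ} (hM : M.Infinite) (n : ℕ) :
    blockSeq (fun M => Finsupp.single (sInf M) 1) M n = Finsupp.single (Nat.nth (· ∈ M) n) 1 := by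
  induction n with
  | zero =>
    rw [Nat.nth_zero]
    rfl
  | succ n ih =>
    rw [blockSeq, ih, Nat.nth_eq_sInf _ (n + 1)]
    refine congrArg (fun S : Set ℕ => Finsupp.single (sInf S) (1 : ℝ)) (Set.ext fun m => ?_)
    simp only [mem_ofPred_eq, Finsupp.support_single _ (one_ne_zero (α := ℝ)),
      Finset.mem_singleton, forall_eq, and_congr_right_iff]
    refine fun _ => ⟨fun h k hk => ?_, fun h => h n (Nat.lt_succ_self n)⟩
    exact ((Nat.nth_monotone hM) (Nat.lt_succ_iff.1 hk)).trans_lt h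

/-- For `ξ = 0` the rule is `M ↦ e_{min M}`; the block sequence of this rule enumerates `M`. -/
theorem exists_isAveraging_repeatedAverage (A : AssociatedSequences) (ξ : Ordinal.{0}) :
    ξ < Ordinal.omega 1 → ∃ first, IsAveraging first ∧ ∀ M : Set ℕ, M.Infinite → M ⊆ Ici 1 →
      repeatedAverage A ξ M = blockSeq first M := by
  induction ξ using Ordinal.limitRecOn with
  | zero =>
    intro _
    refine ⟨_, IsAveraging.single_sInf, fun M hM _ => ?_⟩
    ext1 n
    rw [blockSeq_single_sInf hM, repeatedAverage, Ordinal.limitRecOn_zero]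
  | add_one ζ ih =>
    intro hξ
    obtain ⟨first, hf, he⟩ := ih ((Order.lt_add_one_iff.2 le_rfl).trans hξ)
    refine ⟨_, hf.average.of_eqOn (first' := fun M =>
      ((sInf M : ℕ) : ℝ)⁻¹ • ∑ i ∈ Finset.range (sInf M), repeatedAverage A ζ M i)
      fun L hL hp => by rw [he L hL hp], fun M _ _ => ?_⟩
    rw [repeatedAverage, Ordinal.limitRecOn_add_one]
    rfl
  | limit ξ hlim ih =>
    intro hξ
    have hlt : ∀ m, 1 ≤ m → A.seq ξ m + 1 < ξ := fun m hm => by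
      obtain ⟨hmono, hlub⟩ := (A.isAssociated ξ hξ).2 hlim
      have hm' : m + 1 ∈ Ici 1 := Nat.le_add_left 1 m
      exact (hmono hm hm' (Nat.lt_succ_self m)).trans_le (hlub.1 (mem_image_of_mem _ hm'))
    have hex : ∀ m, ∃ first, 1 ≤ m → IsAveraging first ∧ ∀ M : Set ℕ, M.Infinite → M ⊆ Ici 1 →
        repeatedAverage A (A.seq ξ m + 1) M = blockSeq first M := fun m => by
      by_cases hm : 1 ≤ m
      · obtain ⟨first, h⟩ := ih _ (hlt m hm) ((hlt m hm).trans hξ)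
        exact ⟨first, fun _ => h⟩
      · exact ⟨0, fun h => absurd h hm⟩
    choose G hG using hex
    refine ⟨_, (IsAveraging.diagonal fun m hm => (hG m hm).1).of_eqOn (first' := fun M =>
      if _ : A.seq ξ (sInf M) + 1 < ξ then repeatedAverage A (A.seq ξ (sInf M) + 1) M 0 else 0)
      fun L hL hp => ?_, fun M _ _ => ?_⟩
    · have hm : 1 ≤ sInf L := hp (Nat.sInf_mem hL.nonempty)
      rw [dif_pos (hlt _ hm), (hG _ hm).2 L hL hp]
      rfl
    · rw [repeatedAverage, Ordinal.limitRecOn_limit _ _ _ _ hlim]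
      rfl

/-! ### Removing one coordinate from a functional -/

/-- The value at `μ` of the functional whose value at the `n`-th unit vector is `φ n`. -/
noncomputable abbrev pairing (φ : ℕ → ℝ) : (ℕ →₀ ℝ) →ₗ[ℝ] ℝ := Finsupp.linearCombination ℝ φ

theorem pairing_eq_sum (φ : ℕ → ℝ) (μ : ℕ →₀ ℝ) :
    pairing φ μ = ∑ n ∈ μ.support, μ n * φ n := by
  simp [pairing, Finsupp.linearCombination_apply, Finsupp.sum]

theorem pairing_congr {φ ψ : ℕ → ℝ} {μ : ℕ →₀ ℝ} (h : ∀ n ∈ μ.support, φ n = ψ n) :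
    pairing φ μ = pairing ψ μ := by
  rw [pairing_eq_sum, pairing_eq_sum]
  exact Finset.sum_congr rfl fun n hn => by rw [h n hn]

theorem pairing_eq_zero {φ : ℕ → ℝ} {μ : ℕ →₀ ℝ} (h : ∀ n ∈ μ.support, φ n = 0) :
    pairing φ μ = 0 := by
  rw [pairing_eq_sum]
  exact Finset.sum_eq_zero fun n hn => by rw [h n hn, mul_zero]

theorem abs_pairing_le {φ : ℕ → ℝ} {μ : ℕ →₀ ℝ} {c : ℝ} (h0 : ∀ n, 0 ≤ μ n)
    (h1 : (μ.sum fun _ c => c) = 1) (h : ∀ n ∈ μ.support, |φ n| ≤ c) : |pairing φ μ| ≤ c := by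
  rw [pairing_eq_sum]
  calc |∑ n ∈ μ.support, μ n * φ n| ≤ ∑ n ∈ μ.support, |μ n * φ n| :=
        Finset.abs_sum_le_sum_abs _ _
    _ ≤ ∑ n ∈ μ.support, μ n * c := Finset.sum_le_sum fun n hn => by
        rw [abs_mul, abs_of_nonneg (h0 n)]
        exact mul_le_mul_of_nonneg_left (h n hn) (h0 n)
    _ = c := by
        rw [← Finset.sum_mul]
        rw [Finsupp.sum] at h1
        rw [h1, one_mul]

theorem abs_pairing_sub_le {φ ψ : ℕ → ℝ} {μ : ℕ →₀ ℝ} {c : ℝ} (h0 : ∀ n, 0 ≤ μ n)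
    (h1 : (μ.sum fun _ c => c) = 1) (h : ∀ n ∈ μ.support, |φ n - ψ n| ≤ c) :
    |pairing φ μ - pairing ψ μ| ≤ c := by
  have : pairing φ μ - pairing ψ μ = pairing (fun n => φ n - ψ n) μ := by
    simp only [pairing_eq_sum, mul_sub, Finset.sum_sub_distrib]
  rw [this]
  exact abs_pairing_le h0 h1 h

/-- The properties of the set of sequences `(f (x_n))`, `f` in the dual unit ball, that the
argument uses: `(x_n)` normalized gives `abs_le_one`, bimonotone gives `below` and `above`, and
weakly null gives `tendsto_zero`. -/
structure IsDualBall (K : Set (ℕ → ℝ)) : Prop where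
  isCompact : IsCompact K
  abs_le_one : ∀ φ ∈ K, ∀ n, |φ n| ≤ 1
  below : ∀ φ ∈ K, ∀ r : ℕ, (fun n => if n < r then φ n else 0) ∈ K
  above : ∀ φ ∈ K, ∀ r : ℕ, (fun n => if r ≤ n then φ n else 0) ∈ K
  tendsto_zero : ∀ φ ∈ K, Tendsto φ atTop (𝓝 0)

/-- An infinite set of coordinates has a finite part on which no functional is at least `ε`
throughout: a limit point of such functionals would not tend to zero. -/
theorem IsDualBall.exists_forall_abs_lt {K : Set (ℕ → ℝ)} (hK : IsDualBall K) {ε : ℝ}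
    (hε : 0 < ε) {N : Set ℕ} (hN : N.Infinite) :
    ∃ k, ∀ φ ∈ K, ∃ j ∈ N, j ≤ k ∧ |φ j| < ε := by
  by_contra! hcon
  let T : ℕ → Set (ℕ → ℝ) := fun k => {φ ∈ K | ∀ j ∈ N, j ≤ k → ε ≤ |φ j|}
  have hclosed : ∀ k, IsClosed {φ : ℕ → ℝ | ∀ j ∈ N, j ≤ k → ε ≤ |φ j|} := fun k => by
    simp only [ofPred_forall]
    exact isClosed_iInter fun j => isClosed_iInter fun _ => isClosed_iInter fun _ =>
      isClosed_le continuous_const (continuous_apply j).abs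
  obtain ⟨φ, hφ⟩ := IsCompact.nonempty_iInter_of_sequence_nonempty_isCompact_isClosed T
    (fun k φ hφ => ⟨hφ.1, fun j hj hjk => hφ.2 j hj (hjk.trans (Nat.le_succ k))⟩)
    (fun k => hcon k) (hK.isCompact.inter_right (hclosed 0))
    (fun k => hK.isCompact.isClosed.inter (hclosed k))
  rw [mem_iInter] at hφ
  have h0 := (hK.tendsto_zero φ (hφ 0).1).abs
  rw [abs_zero] at h0
  obtain ⟨k, hk⟩ := eventually_atTop.1 (h0.eventually (gt_mem_nhds hε))
  obtain ⟨j, hj, hkj⟩ := hN.exists_gt k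
  exact absurd (hk j hkj.le) (not_lt.2 ((hφ j).2 j hj le_rfl))

/-- `φ` is nonnegative on the first `n` blocks of `L`, and its values there add up to at least
`s`. -/
def IsLargeOn (first : Set ℕ → (ℕ →₀ ℝ)) (L : Set ℕ) (n : ℕ) (s : ℝ) (φ : ℕ → ℝ) : Prop :=
  (∀ i < n, 0 ≤ pairing φ (blockSeq first L i)) ∧
    s ≤ ∑ i ∈ Finset.range n, pairing φ (blockSeq first L i)

/-- A functional that is large on the first blocks of `L` may be taken to vanish on all further
blocks, and is then large on any larger number of blocks. This is why the thresholds `s`, unlike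
sign patterns or level sets, let a single functional serve many sets at a time. -/
theorem IsDualBall.exists_isLargeOn_of_le {K : Set (ℕ → ℝ)} (hK : IsDualBall K)
    {first : Set ℕ → (ℕ →₀ ℝ)} (h : IsAveraging first) {L : Set ℕ} (hL : L.Infinite)
    (hp : L ⊆ Ici 1) {n : ℕ} {s : ℝ} {φ : ℕ → ℝ} (hφ : φ ∈ K) (hlarge : IsLargeOn first L n s φ) :
    ∃ ψ ∈ K, (∀ m, (∀ l ∈ L, m < l) → ψ m = φ m) ∧ ∀ k, n ≤ k → IsLargeOn first L k s ψ := by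
  obtain ⟨r, hr⟩ := h.blockSeq_support_nonempty hL hp n
  let r' := (blockSeq first L n).support.min' ⟨r, hr⟩
  have hr' : r' ∈ (blockSeq first L n).support := Finset.min'_mem _ _
  let ψ : ℕ → ℝ := fun n => if n < r' then φ n else 0
  have hlt : ∀ i < n, pairing ψ (blockSeq first L i) = pairing φ (blockSeq first L i) :=
    fun i hi => pairing_congr fun m hm => if_pos (h.blockSeq_lt i hL hp n hi m hm r' hr')
  have hge : ∀ i, n ≤ i → pairing ψ (blockSeq first L i) = 0 := by
    refine fun i hi => pairing_eq_zero fun m hm => if_neg (not_lt.2 ?_)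
    rcases hi.lt_or_eq with hi | rfl
    · exact (h.blockSeq_lt n hL hp i hi r' hr' m hm).le
    · exact Finset.min'_le _ _ hm
  refine ⟨ψ, hK.below φ hφ r', fun m hm => if_pos (hm r' (h.blockSeq_support_subset hL hp n r' hr')),
    fun k hk => ⟨fun i _ => ?_, ?_⟩⟩
  · rcases lt_or_ge i n with hi | hi
    · rw [hlt i hi]
      exact hlarge.1 i hi
    · rw [hge i hi]
  · have hsub : Finset.range n ⊆ Finset.range k := Finset.range_mono hk
    rw [← Finset.sum_subset hsub fun i _ hi =>
      hge i (not_lt.1 fun h => hi (Finset.mem_range.2 h))]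
    rw [Finset.sum_congr rfl fun i hi => hlt i (Finset.mem_range.1 hi)]
    exact hlarge.2

/-- Within a cell of functionals that are close to `t` on `P`, largeness with threshold `s` on
blocks beyond `l` can be had with a small value at `l`. -/
theorem IsDualBall.exists_subset_small_at_in_cell {K : Set (ℕ → ℝ)} (hK : IsDualBall K)
    {first : Set ℕ → (ℕ →₀ ℝ)} (h : IsAveraging first) (P : Finset ℕ) {ε : ℝ} (hε : 0 < ε)
    (t : ℕ → ℝ) (s : ℝ) {N : Set ℕ} (hN : N.Infinite) (hp : N ⊆ Ici 1)
    (hPN : ∀ p ∈ P, ∀ m ∈ N, p < m) :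
    ∃ N' ⊆ N, N'.Infinite ∧ ∀ l ∈ N', ∀ L ⊆ N', L.Infinite → (∀ m ∈ L, l < m) →
      ∀ n, ∀ φ ∈ K, (∀ p ∈ P, |φ p - t p| < ε) → IsLargeOn first L n s φ →
        ∃ ψ ∈ K, (∀ p ∈ P, |ψ p - t p| < ε) ∧ IsLargeOn first L n s ψ ∧ |ψ l| < ε := by
  let bad : ℕ → Set ℕ → ℕ → Prop := fun l L n =>
    (∃ φ ∈ K, (∀ p ∈ P, |φ p - t p| < ε) ∧ IsLargeOn first L n s φ) ∧
      ∀ φ ∈ K, (∀ p ∈ P, |φ p - t p| < ε) → IsLargeOn first L n s φ → ε ≤ |φ l|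
  have bad_congr : ∀ (l : ℕ) (L L' : Set ℕ) (n : ℕ),
      (∀ i < n, blockSeq first L' i = blockSeq first L i) → bad l L n → bad l L' n := by
    intro l L L' n he
    have : ∀ φ, IsLargeOn first L' n s φ ↔ IsLargeOn first L n s φ := fun φ => by
      have h1 : ∑ i ∈ Finset.range n, pairing φ (blockSeq first L' i) =
          ∑ i ∈ Finset.range n, pairing φ (blockSeq first L i) :=
        Finset.sum_congr rfl fun i hi => by rw [he i (Finset.mem_range.1 hi)]
      rw [IsLargeOn, IsLargeOn, h1]
      exact and_congr_left' (forall₂_congr fun i hi => by rw [he i hi])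
    simp only [bad, this, imp_self]
  let rest : Set ℕ → Set ℕ := fun L => {m ∈ L | sInf L < m}
  have rest_inf : ∀ L : Set ℕ, L.Infinite → (rest L).Infinite := fun L hL =>
    (hL.sdiff (finite_Iic (sInf L))).mono fun _ hb => ⟨hb.1, not_le.1 hb.2⟩
  obtain ⟨N', hN'N, hN', hhom⟩ := exists_homogeneous_of_open
    (fun L => L ⊆ Ici 1 ∧ ∃ n, bad (sInf L) (rest L) n) (by
      rintro L hL ⟨hLp, n, hbad⟩
      let B := max (sInf L) (((Finset.range n).biUnion fun i =>
        (blockSeq first (rest L) i).support).sup id)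
      refine ⟨B, fun L' hL' hag => ?_⟩
      have hinf : sInf L' = sInf L := by
        have h1 : sInf L' ≤ sInf L :=
          Nat.sInf_le ((hag _ (le_max_left _ _)).2 (Nat.sInf_mem hL.nonempty))
        exact le_antisymm h1 (Nat.sInf_le
          ((hag _ (h1.trans (le_max_left _ _))).1 (Nat.sInf_mem hL'.nonempty)))
      have hLp' : L' ⊆ Ici 1 := fun m hm => by
        by_contra h0
        obtain rfl : m = 0 := by simpa using h0
        exact h0 (hLp ((hag 0 (Nat.zero_le _)).1 hm))
      refine ⟨hLp', n, ?_⟩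
      rw [hinf]
      refine bad_congr _ _ _ _ (h.blockSeq_congr n (rest_inf L hL) ((sep_subset _ _).trans hLp)
        (rest_inf L' hL') ((sep_subset _ _).trans hLp') fun i hi j hj m hm => ?_) hbad
      have hmB : m ≤ B := hm.trans ((Finset.le_sup (f := id) (Finset.mem_biUnion.2
        ⟨i, Finset.mem_range.2 hi, hj⟩)).trans (le_max_right _ _))
      simp only [rest, mem_ofPred_eq, hag m hmB, hinf]) N hN
  rcases hhom with hall | hnone
  · exfalso
    obtain ⟨k, hk⟩ := hK.exists_forall_abs_lt hε hN'
    -- All points of `N'` up to `k` are followed by the same set `L`.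
    let L : Set ℕ := {m ∈ N' | k < m}
    have hL : L.Infinite := (hN'.sdiff (finite_Iic k)).mono fun _ hb => ⟨hb.1, not_le.1 hb.2⟩
    have hLp : L ⊆ Ici 1 := (sep_subset _ _).trans (hN'N.trans hp)
    have hbad : ∀ j ∈ N', j ≤ k → ∃ n, bad j L n := by
      intro j hj hjk
      have hmem : ∀ m ∈ insert j L, j ≤ m := by
        rintro m (rfl | hm)
        · exact le_rfl
        · exact hjk.trans hm.2.le
      have hinf : sInf (insert j L) = j :=
        le_antisymm (Nat.sInf_le (mem_insert _ _)) (le_csInf (insert_nonempty _ _) hmem)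
      have hrest : rest (insert j L) = L := by
        ext m
        simp only [rest, mem_ofPred_eq, hinf]
        refine ⟨fun hm => hm.1.resolve_left hm.2.ne', fun hm => ⟨Or.inr hm, hjk.trans_lt hm.2⟩⟩
      have := (hall (insert j L) (insert_subset hj (sep_subset _ _))
        (hL.mono (subset_insert _ _))).2
      rwa [hinf, hrest] at this
    have hne : ∃ n, ∃ j ∈ N', j ≤ k ∧ bad j L n := by
      obtain ⟨φ, hφ⟩ : K.Nonempty := by
        obtain ⟨j, hj⟩ := hN'.nonempty
        obtain ⟨⟨φ, hφ, -⟩, -⟩ := (hall N' subset_rfl hN').2.choose_spec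
        exact ⟨φ, hφ⟩
      obtain ⟨j, hj, hjk, -⟩ := hk φ hφ
      obtain ⟨n, hn⟩ := hbad j hj hjk
      exact ⟨n, j, hj, hjk, hn⟩
    classical
    obtain ⟨j₀, hj₀, hj₀k, ⟨φ, hφK, hφP, hφ⟩, -⟩ := Nat.find_spec hne
    obtain ⟨ψ, hψK, hψeq, hψ⟩ := hK.exists_isLargeOn_of_le h hL hLp hφK hφ
    obtain ⟨j, hj, hjk, hlt⟩ := hk ψ hψK
    obtain ⟨n, hn⟩ := hbad j hj hjk
    refine absurd hlt (not_lt.2 (hn.2 ψ hψK (fun p hpP => ?_)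
      (hψ n (Nat.find_min' hne ⟨j, hj, hjk, hn⟩))))
    rw [hψeq p fun l hl => hPN p hpP l (hN'N hl.1)]
    exact hφP p hpP
  · refine ⟨N', hN'N, hN', fun l hl L hL hLi hlL n φ hφK hφP hφ => ?_⟩
    have hmem : ∀ m ∈ insert l L, l ≤ m := by
      rintro m (rfl | hm)
      · exact le_rfl
      · exact (hlL m hm).le
    have hinf : sInf (insert l L) = l :=
      le_antisymm (Nat.sInf_le (mem_insert _ _)) (le_csInf (insert_nonempty _ _) hmem)
    have hrest : rest (insert l L) = L := by
      ext m
      simp only [rest, mem_ofPred_eq, hinf]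
      exact ⟨fun hm => hm.1.resolve_left hm.2.ne', fun hm => ⟨Or.inr hm, hlL m hm⟩⟩
    have hsub : insert l L ⊆ N' := insert_subset hl hL
    have := hnone _ hsub (hLi.mono (subset_insert _ _))
    rw [hinf, hrest] at this
    by_contra! hcon
    exact this ⟨hsub.trans (hN'N.trans hp), n, ⟨φ, hφK, hφP, hφ⟩, hcon⟩

/-- The value at `l` can be made small at the cost of `2 * ε`, on `P` and in the sum over the
blocks of `L`. -/
def CanRemove (K : Set (ℕ → ℝ)) (first : Set ℕ → (ℕ →₀ ℝ)) (P : Finset ℕ) (ε S : ℝ) (l : ℕ)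
    (L : Set ℕ) : Prop :=
  ∀ n s, s ≤ S → ∀ φ ∈ K, IsLargeOn first L n s φ →
    ∃ ψ ∈ K, (∀ p ∈ P, |ψ p - φ p| ≤ 2 * ε) ∧ IsLargeOn first L n (s - 2 * ε) ψ ∧ |ψ l| ≤ ε

/-- By compactness finitely many cells and thresholds account for all functionals and all
thresholds up to `S`. -/
theorem IsDualBall.exists_subset_canRemove {K : Set (ℕ → ℝ)} (hK : IsDualBall K)
    {first : Set ℕ → (ℕ →₀ ℝ)} (h : IsAveraging first) (P : Finset ℕ) {ε : ℝ} (hε : 0 < ε)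
    {S : ℝ} (hS : 0 ≤ S) {N : Set ℕ} (hN : N.Infinite) (hp : N ⊆ Ici 1)
    (hPN : ∀ p ∈ P, ∀ m ∈ N, p < m) :
    ∃ N' ⊆ N, N'.Infinite ∧ ∀ l ∈ N', ∀ L ⊆ N', L.Infinite → (∀ m ∈ L, l < m) →
      CanRemove K first P ε S l L := by
  classical
  let V : (ℕ → ℝ) × ℝ → Set ((ℕ → ℝ) × ℝ) := fun q =>
    {w | (∀ p ∈ P, |w.1 p - q.1 p| < ε) ∧ |w.2 - q.2| < ε}
  have hV : ∀ q, IsOpen (V q) := fun q => by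
    refine IsOpen.inter (s := {w : (ℕ → ℝ) × ℝ | ∀ p ∈ P, |w.1 p - q.1 p| < ε}) ?_ ?_
    · simp only [ofPred_forall]
      refine isOpen_biInter_finset fun p _ => isOpen_lt ?_ continuous_const
      exact (((continuous_apply p).comp continuous_fst).sub continuous_const).abs
    · exact isOpen_lt (continuous_snd.sub continuous_const).abs continuous_const
  obtain ⟨T, hT⟩ := (hK.isCompact.prod (isCompact_Icc (a := (0 : ℝ)) (b := S))).elim_finite_subcover
    V hV fun q _ => mem_iUnion.2 ⟨q, by simp [V, hε]⟩
  have main : ∀ T : Finset ((ℕ → ℝ) × ℝ), ∃ N' ⊆ N, N'.Infinite ∧ ∀ q ∈ T, ∀ l ∈ N', ∀ L ⊆ N',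
      L.Infinite → (∀ m ∈ L, l < m) → ∀ n, ∀ φ ∈ K, (∀ p ∈ P, |φ p - q.1 p| < ε) →
        IsLargeOn first L n (q.2 - ε) φ → ∃ ψ ∈ K, (∀ p ∈ P, |ψ p - q.1 p| < ε) ∧
          IsLargeOn first L n (q.2 - ε) ψ ∧ |ψ l| < ε := by
    intro T
    induction T using Finset.induction_on with
    | empty => exact ⟨N, subset_rfl, hN, by simp⟩
    | insert q T _ ih =>
      obtain ⟨N₁, hN₁N, hN₁, h₁⟩ := ih
      obtain ⟨N₂, hN₂N, hN₂, h₂⟩ := hK.exists_subset_small_at_in_cell h P hε q.1 (q.2 - ε) hN₁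
        (hN₁N.trans hp) fun p hp m hm => hPN p hp m (hN₁N hm)
      refine ⟨N₂, hN₂N.trans hN₁N, hN₂, fun q' hq' l hl L hL => ?_⟩
      rcases Finset.mem_insert.1 hq' with rfl | hq'
      · exact h₂ l hl L hL
      · exact h₁ q' hq' l (hN₂N hl) L (hL.trans hN₂N)
  obtain ⟨N', hN'N, hN', hmain⟩ := main T
  refine ⟨N', hN'N, hN', fun l hl L hL hLi hlL n s hs φ hφK hφ => ?_⟩
  have hφ' : (φ, max s 0) ∈ K ×ˢ Icc 0 S := ⟨hφK, le_max_right _ _, max_le hs hS⟩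
  obtain ⟨q, hqT, hq⟩ := mem_iUnion₂.1 (hT hφ')
  have hsum : max s 0 ≤ ∑ i ∈ Finset.range n, pairing φ (blockSeq first L i) :=
    max_le hφ.2 (Finset.sum_nonneg fun i hi => hφ.1 i (Finset.mem_range.1 hi))
  have hq2 := abs_lt.1 hq.2
  dsimp only at hq2
  obtain ⟨ψ, hψK, hψP, hψ, hψl⟩ := hmain q hqT l hl L hL hLi hlL n φ hφK hq.1
    ⟨hφ.1, by linarith⟩
  refine ⟨ψ, hψK, fun p hpP => ?_, ⟨hψ.1, ?_⟩, hψl.le⟩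
  · have h1 := abs_lt.1 (hψP p hpP)
    have h2 := abs_lt.1 (hq.1 p hpP)
    dsimp only at h2
    rw [abs_le]
    constructor <;> linarith
  · have := le_max_left s 0
    have := hψ.2
    linarith

/-! ### Removing the blocks outside a given set of blocks -/

/-- The number of elements of `M` below `l`. -/
noncomputable def rank (M : Set ℕ) (l : ℕ) : ℕ := by
  classical exact ((Finset.range l).filter (· ∈ M)).card

/-- The error `2 ^ (-k)` allowed in the removal of the point `l` with `k` predecessors in `M`. -/
noncomputable def err (M : Set ℕ) (l : ℕ) : ℝ := (1 / 2) ^ rank M l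

open Classical in
theorem rank_mono (M : Set ℕ) {a b : ℕ} (h : a ≤ b) : rank M a ≤ rank M b :=
  Finset.card_le_card (Finset.filter_subset_filter _ (Finset.range_mono h))

open Classical in
theorem rank_lt {M : Set ℕ} {a b : ℕ} (ha : a ∈ M) (h : a < b) : rank M a < rank M b := by
  refine Finset.card_lt_card (Finset.ssubset_iff_subset_ne.2
    ⟨Finset.filter_subset_filter _ (Finset.range_mono h.le), fun he => ?_⟩)
  have : a ∈ (Finset.range b).filter (· ∈ M) := by simp [ha, h]
  rw [← he] at this
  simp at this

theorem err_pos (M : Set ℕ) (l : ℕ) : 0 < err M l := by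
  unfold err
  positivity

theorem err_le_one (M : Set ℕ) (l : ℕ) : err M l ≤ 1 :=
  pow_le_one₀ (by norm_num) (by norm_num)

theorem err_le_half {M : Set ℕ} {a b : ℕ} (ha : a ∈ M) (h : a < b) :
    err M b ≤ err M a / 2 := by
  have : err M b ≤ (1 / 2) ^ (rank M a + 1) :=
    pow_le_pow_of_le_one (by norm_num) (by norm_num) (rank_lt ha h)
  rwa [pow_succ, ← div_eq_mul_one_div] at this

/-- The errors at points of `M` in `[a, b)` form a geometric sum. -/
theorem sum_err_le {M : Set ℕ} {a : ℕ} (E : Finset ℕ) : ∀ b, a ≤ b → (∀ l ∈ E, l ∈ M) →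
    (∀ l ∈ E, a ≤ l ∧ l < b) → ∑ l ∈ E, err M l ≤ 2 * (err M a - err M b) := by
  induction E using Finset.induction_on_max with
  | empty =>
    intro b hab _ _
    have : err M b ≤ err M a := pow_le_pow_of_le_one (by norm_num) (by norm_num) (rank_mono M hab)
    simpa using this
  | insert x E hx ih =>
    intro b hab hM hE
    have hxE : x ∉ E := fun h => lt_irrefl x (hx x h)
    have hxb := hE x (Finset.mem_insert_self _ _)
    have h1 := ih x hxb.1 (fun l hl => hM l (Finset.mem_insert_of_mem hl))
      fun l hl => ⟨(hE l (Finset.mem_insert_of_mem hl)).1, hx l hl⟩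
    have h2 := err_le_half (hM x (Finset.mem_insert_self _ _)) hxb.2
    rw [Finset.sum_insert hxE]
    linarith

open Classical in
/-- Every point of `M` can be removed in favour of the blocks of any set of later points of `M`,
without harm to the earlier points of `M`. The bound on the threshold grows with the rank of the
point. -/
def IsRemovable (K : Set (ℕ → ℝ)) (first : Set ℕ → (ℕ →₀ ℝ)) (M : Set ℕ) : Prop :=
  ∀ l ∈ M, ∀ L ⊆ M, L.Infinite → (∀ m ∈ L, l < m) →
    CanRemove K first ((Finset.range l).filter (· ∈ M)) (err M l) (rank M l + 1) l L

theorem IsDualBall.exists_isRemovable {K : Set (ℕ → ℝ)} (hK : IsDualBall K)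
    {first : Set ℕ → (ℕ →₀ ℝ)} (h : IsAveraging first) :
    ∃ M ⊆ Ici 1, M.Infinite ∧ IsRemovable K first M := by
  classical
  obtain ⟨M, hM1, hM, hrem⟩ := exists_infinite_fusion
    (fun P A => ∀ l ∈ A, ∀ L ⊆ A, L.Infinite → (∀ m ∈ L, l < m) →
      CanRemove K first P ((1 / 2) ^ P.card) (P.card + 1) l L)
    (fun P A B hBA hA l hl L hL => hA l (hBA hl) L (hL.trans hBA))
    (fun P A hA => by
      obtain ⟨N, hN, hNi, hrem⟩ := hK.exists_subset_canRemove h P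
        (ε := (1 / 2) ^ P.card) (by positivity) (S := P.card + 1) (by positivity)
        (hA.sdiff (finite_Iic (P.sup id)))
        (fun m hm => Nat.one_le_iff_ne_zero.2 fun h0 => hm.2 (h0 ▸ Nat.zero_le _))
        fun p hp m hm => (Finset.le_sup (f := id) hp).trans_lt (not_le.1 hm.2)
      exact ⟨N, hN.trans sdiff_subset, hNi, hrem⟩) (Ici 1) (Ici_infinite 1)
  refine ⟨M, hM1, hM, fun l hl L hL hLi hlL => ?_⟩
  refine hrem ((Finset.range l).filter (· ∈ M)) (fun p hp => ?_) l ⟨hl, fun p hp => ?_⟩ L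
    (fun m hm => ⟨hL hm, fun p hp => ?_⟩) hLi hlL
  · exact (Finset.mem_filter.1 hp).2
  · exact Finset.mem_range.1 (Finset.mem_filter.1 hp).1
  · exact (Finset.mem_range.1 (Finset.mem_filter.1 hp).1).trans (hlL m hm)

theorem sInf_lt_sInf_afterBlock (first : Set ℕ → (ℕ →₀ ℝ)) {L : Set ℕ}
    (hL : L.Infinite) : ∀ l ∈ (first L).support, l < sInf (afterBlock first L) :=
  (Nat.sInf_mem (infinite_afterBlock first hL).nonempty).2

namespace IsRemovable

variable {K : Set (ℕ → ℝ)} {first : Set ℕ → (ℕ →₀ ℝ)} {M : Set ℕ}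

/-- The points of `E` are removed in increasing order: a later removal hardly affects the earlier
points, and the blocks of `L` stay large throughout. -/
theorem remove_finset (hM : IsRemovable K first M) {L : Set ℕ} (hLM : L ⊆ M) (hL : L.Infinite)
    {n : ℕ} {s : ℝ} {φ : ℕ → ℝ} (hφK : φ ∈ K) (hφ : IsLargeOn first L n s φ) (E : Finset ℕ) :
    (∀ l ∈ E, l ∈ M) → (∀ l ∈ E, ∀ m ∈ L, l < m) → (∀ l ∈ E, s ≤ rank M l + 1) →
    ∃ ψ ∈ K, IsLargeOn first L n (s - 2 * ∑ l ∈ E, err M l) ψ ∧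
      (∀ p ∈ M, (∀ l ∈ E, p < l) → |ψ p - φ p| ≤ 2 * ∑ l ∈ E, err M l) ∧
      ∀ l ∈ E, |ψ l| ≤ 2 * ∑ l ∈ E, err M l := by
  induction E using Finset.induction_on_max with
  | empty => exact fun _ _ _ => ⟨φ, hφK, by simpa using hφ, by simp, by simp⟩
  | insert x E hx ih =>
    intro hEM hEL hs
    have hxE : x ∉ E := fun h => lt_irrefl x (hx x h)
    have hxM := hEM x (Finset.mem_insert_self _ _)
    obtain ⟨ψ, hψK, hψ, hψφ, hψE⟩ := ih (fun l hl => hEM l (Finset.mem_insert_of_mem hl))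
      (fun l hl => hEL l (Finset.mem_insert_of_mem hl))
      (fun l hl => hs l (Finset.mem_insert_of_mem hl))
    have h0 : 0 ≤ ∑ l ∈ E, err M l := Finset.sum_nonneg fun l _ => (err_pos M l).le
    have hx0 := err_pos M x
    obtain ⟨χ, hχK, hχψ, hχ, hχx⟩ := hM x hxM L hLM hL (hEL x (Finset.mem_insert_self _ _)) n
      (s - 2 * ∑ l ∈ E, err M l) (by linarith [hs x (Finset.mem_insert_self _ _)]) ψ hψK hψ
    have hnear : ∀ p ∈ M, p < x → |χ p - ψ p| ≤ 2 * err M x := fun p hp hpx =>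
      hχψ p (by simp [hp, hpx])
    rw [Finset.sum_insert hxE]
    refine ⟨χ, hχK, ⟨hχ.1, by linarith [hχ.2]⟩, fun p hp hpE => ?_, fun l hl => ?_⟩
    · have h1 := hnear p hp (hpE x (Finset.mem_insert_self _ _))
      have h2 := hψφ p hp fun l hl => hpE l (Finset.mem_insert_of_mem hl)
      have := abs_sub_le (χ p) (ψ p) (φ p)
      linarith
    · rcases Finset.mem_insert.1 hl with rfl | hl
      · linarith
      · have h1 := hnear l (hEM l (Finset.mem_insert_of_mem hl)) (hx l hl)
        have h2 := hψE l hl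
        have := abs_sub_abs_le_abs_sub (χ l) (ψ l)
        linarith

/-- A functional that is nonnegative on the blocks in `F` can be traded for one that is nearly as
large on these blocks and nearly zero on the others. The errors at successive points of `M` are at
most halved each time, so that all of them together are bounded by multiples of the first. -/
theorem exists_le_sum_mul_pairing (hM : IsRemovable K first M) (h : IsAveraging first)
    (hM1 : M ⊆ Ici 1) {δ : ℝ} (hδ : 0 < δ) (hδ1 : δ ≤ 1) (n : ℕ) :
    ∀ {L : Set ℕ}, L ⊆ M → L.Infinite → ∀ (F : ℕ → Prop) [DecidablePred F] (a : ℕ → ℝ),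
    (∀ i < n, |a i| ≤ 1) →
    (∀ i < n, F i → δ ≤ a i) → ∀ φ ∈ K, (∀ i < n, F i → 0 ≤ pairing φ (blockSeq first L i)) →
    ∀ s, s ≤ (∑ i ∈ Finset.range n, if F i then pairing φ (blockSeq first L i) else 0) →
    s ≤ rank M (sInf L) + 1 →
    ∃ ψ ∈ K, (∀ p ∈ M, p < sInf L → |ψ p - φ p| ≤ 4 * err M (sInf L)) ∧
      δ * s - 12 * err M (sInf L) ≤
        ∑ i ∈ Finset.range n, a i * pairing ψ (blockSeq first L i) := by
  induction n with
  | zero =>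
    intro L hLM hL F _ a _ _ φ hφK _ s hs _
    have h0 := err_pos M (sInf L)
    refine ⟨φ, hφK, fun p _ _ => by simpa using h0.le, ?_⟩
    simp only [Finset.range_zero, Finset.sum_empty] at hs ⊢
    nlinarith
  | succ n ih =>
    intro L hLM hL F _ a ha hFa φ hφK hφ s hs hsr
    have hp : L ⊆ Ici 1 := hLM.trans hM1
    have hqM : sInf L ∈ M := hLM (Nat.sInf_mem hL.nonempty)
    have hEq := sInf_lt_sInf_afterBlock first hL
    have hq := hEq _ (h.sInf_mem_support hL hp)
    have hL₁ := infinite_afterBlock first hL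
    have hL₁M : afterBlock first L ⊆ M := (afterBlock_subset first L).trans hLM
    have he := err_le_half hqM hq
    have he0 := err_pos M (sInf L)
    have he1 := err_pos M (sInf (afterBlock first L))
    have hr : (rank M (sInf L) : ℝ) ≤ rank M (sInf (afterBlock first L)) :=
      Nat.cast_le.2 (rank_mono M hq.le)
    have hEM : ∀ l ∈ (first L).support, l ∈ M := fun l hl => hLM (h.support_subset L hL hp l hl)
    have h0 := h.nonneg L hL hp
    have h1 := h.sum_eq_one L hL hp
    have hb : ∀ i, blockSeq first L (i + 1) = blockSeq first (afterBlock first L) i :=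
      h.blockSeq_succ hL hp
    have hb0 : blockSeq first L 0 = first L := rfl
    have ha0 := abs_le.1 (ha 0 n.succ_pos)
    rw [Finset.sum_range_succ'] at hs
    simp only [Finset.sum_range_succ', hb, hb0] at hs ⊢
    have ih' := ih hL₁M hL₁ (fun i => F (i + 1)) (fun i => a (i + 1))
      (fun i hi => ha _ (Nat.succ_lt_succ hi)) (fun i hi => hFa _ (Nat.succ_lt_succ hi))
    -- A first block in `F` keeps its value up to the later errors; the points of any other first
    -- block are removed before the remaining blocks are treated.
    by_cases hF : F 0
    · have hφ0 : 0 ≤ pairing φ (first L) := hφ 0 n.succ_pos hF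
      rw [if_pos hF] at hs
      obtain ⟨ψ, hψK, hψφ, hψ⟩ := ih' φ hφK
        (fun i hi hFi => hb i ▸ hφ _ (Nat.succ_lt_succ hi) hFi) (s - pairing φ (first L))
        (by linarith) (by linarith)
      refine ⟨ψ, hψK, fun p hpM hpq => (hψφ p hpM (hpq.trans hq)).trans (by linarith), ?_⟩
      have h2 := abs_le.1 (abs_pairing_sub_le h0 h1 fun l hl => hψφ l (hEM l hl) (hEq l hl))
      have hFa0 := hFa 0 n.succ_pos hF
      have h3 : a 0 * (pairing φ (first L) - 4 * err M (sInf (afterBlock first L))) ≤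
          a 0 * pairing ψ (first L) := mul_le_mul_of_nonneg_left (by linarith) (by linarith)
      have h4 : δ * pairing φ (first L) ≤ a 0 * pairing φ (first L) :=
        mul_le_mul_of_nonneg_right hFa0 hφ0
      have h5 : a 0 * err M (sInf (afterBlock first L)) ≤ 1 * err M (sInf (afterBlock first L)) :=
        mul_le_mul_of_nonneg_right ha0.2 he1.le
      linarith
    · rw [if_neg hF, add_zero] at hs
      have hsum : ∑ l ∈ (first L).support, err M l ≤
          2 * (err M (sInf L) - err M (sInf (afterBlock first L))) :=
        sum_err_le _ _ hq.le hEM fun l hl =>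
          ⟨Nat.sInf_le (h.support_subset L hL hp l hl), hEq l hl⟩
      have hsum0 : 0 ≤ ∑ l ∈ (first L).support, err M l :=
        Finset.sum_nonneg fun l _ => (err_pos M l).le
      obtain ⟨L', hL'L, hL', r, hr1, hr2, hr3⟩ := h.exists_blockSeq_subfamily n hL₁
        (hL₁M.trans hM1) fun i => F (i + 1)
      have hsr' : ∀ l ∈ (first L).support, s ≤ rank M l + 1 := fun l hl => by
        have : (rank M (sInf L) : ℝ) ≤ rank M l :=
          Nat.cast_le.2 (rank_mono M (Nat.sInf_le (h.support_subset L hL hp l hl)))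
        linarith
      obtain ⟨χ, hχK, hχ, hχφ, hχE⟩ := hM.remove_finset (hL'L.trans hL₁M) hL' (n := r) (s := s)
        hφK ⟨fun j hj => by
            obtain ⟨i, hi, hFi, he⟩ := hr1 j hj
            rw [he, ← hb]
            exact hφ _ (Nat.succ_lt_succ hi) hFi,
          by rw [hr3 (fun μ => pairing φ μ)]; exact hs⟩
        (first L).support hEM (fun l hl m hm => (hL'L hm).2 l hl) hsr'
      have hχs := hχ.2
      rw [hr3 (fun μ => pairing χ μ)] at hχs
      obtain ⟨ψ, hψK, hψχ, hψ⟩ := ih' χ hχK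
        (fun i hi hFi => by
          obtain ⟨j, hj, he⟩ := hr2 i hi hFi
          exact he ▸ hχ.1 j hj)
        (s - 2 * ∑ l ∈ (first L).support, err M l) hχs (by linarith)
      refine ⟨ψ, hψK, fun p hpM hpq => ?_, ?_⟩
      · have h2 := hψχ p hpM (hpq.trans hq)
        have h3 := hχφ p hpM fun l hl =>
          hpq.trans_le (Nat.sInf_le (h.support_subset L hL hp l hl))
        have := abs_sub_le (ψ p) (χ p) (φ p)
        linarith
      · have h2 : |pairing ψ (first L)| ≤ 2 * (∑ l ∈ (first L).support, err M l) +
            4 * err M (sInf (afterBlock first L)) := by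
          refine abs_pairing_le h0 h1 fun l hl => ?_
          have h3 := hψχ l (hEM l hl) (hEq l hl)
          have h4 := hχE l hl
          have := abs_sub_abs_le_abs_sub (ψ l) (χ l)
          linarith
        have h3 : |a 0 * pairing ψ (first L)| ≤ 1 * |pairing ψ (first L)| := by
          rw [abs_mul]
          exact mul_le_mul_of_nonneg_right (ha 0 n.succ_pos) (abs_nonneg _)
        have h4 := (abs_le.1 h3).1
        have h5 : δ * ∑ l ∈ (first L).support, err M l ≤ 1 * ∑ l ∈ (first L).support, err M l :=
          mul_le_mul_of_nonneg_right hδ1 hsum0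
        linarith

/-- The blocks from the `p`-th on are the blocks of a set all of whose points have rank at least `p`,
because each of the blocks before contains a point of `M`. -/
theorem exists_drop (h : IsAveraging first) (hM1 : M ⊆ Ici 1) {L : Set ℕ} (hLM : L ⊆ M)
    (hL : L.Infinite) (p : ℕ) : ∃ L' ⊆ L, L'.Infinite ∧
      (∀ i, blockSeq first L (p + i) = blockSeq first L' i) ∧ p ≤ rank M (sInf L') := by
  induction p with
  | zero => exact ⟨L, subset_rfl, hL, by simp, Nat.zero_le _⟩
  | succ p ih =>
    obtain ⟨L', hL'L, hL', hb, hr⟩ := ih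
    have hp : L' ⊆ Ici 1 := hL'L.trans (hLM.trans hM1)
    refine ⟨_, (afterBlock_subset first L').trans hL'L, infinite_afterBlock first hL',
      fun i => ?_, hr.trans_lt ?_⟩
    · rw [← h.blockSeq_succ hL' hp, ← hb, add_right_comm, add_assoc]
    · exact rank_lt (hLM (hL'L (Nat.sInf_mem hL'.nonempty)))
        (sInf_lt_sInf_afterBlock first hL' _ (h.sInf_mem_support hL' hp))

/-- The bound of `exists_le_sum_mul_pairing` without restriction on the threshold, for half of the
sum. -/
theorem exists_half_le_sum_mul_pairing (hM : IsRemovable K first M) (hK : IsDualBall K)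
    (h : IsAveraging first) (hM1 : M ⊆ Ici 1) {δ : ℝ} (hδ : 0 < δ) (hδ1 : δ ≤ 1) (n : ℕ)
    {L : Set ℕ} (hLM : L ⊆ M) (hL : L.Infinite) (F : ℕ → Prop) [DecidablePred F] (a : ℕ → ℝ)
    (ha : ∀ i < n, |a i| ≤ 1) (hFa : ∀ i < n, F i → δ ≤ a i) (φ : ℕ → ℝ) (hφK : φ ∈ K)
    (hφ : ∀ i < n, F i → 0 ≤ pairing φ (blockSeq first L i)) :
    ∃ ψ ∈ K, δ * ((∑ i ∈ Finset.range n, if F i then pairing φ (blockSeq first L i) else 0) / 2)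
      - 12 ≤ ∑ i ∈ Finset.range n, a i * pairing ψ (blockSeq first L i) := by
  have hp : L ⊆ Ici 1 := hLM.trans hM1
  obtain ⟨T, hT⟩ :
    ∃ T, T = ∑ i ∈ Finset.range n, if F i then pairing φ (blockSeq first L i) else 0 := ⟨_, rfl⟩
  rw [← hT]
  have hone : ∀ i, (if F i then pairing φ (blockSeq first L i) else 0) ≤ 1 := fun i => by
    split_ifs
    · exact (abs_le.1 (abs_pairing_le (h.blockSeq_nonneg hL hp i) (h.blockSeq_sum_eq_one hL hp i)
        fun l _ => hK.abs_le_one φ hφK l)).2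
    · exact zero_le_one
  have hT0 : 0 ≤ T := hT ▸ Finset.sum_nonneg fun i hi => by
    split_ifs with hF
    · exact hφ i (Finset.mem_range.1 hi) hF
    · exact le_rfl
  have hTn : T ≤ n := by
    rw [hT]
    simpa using Finset.sum_le_sum fun i (_ : i ∈ Finset.range n) => hone i
  -- The first `p` blocks carry at most half of the sum; once they are dropped, the rank of every
  -- remaining point is large enough for the threshold `T / 2`.
  let p := ⌊T / 2⌋₊
  have hpT : (p : ℝ) ≤ T / 2 := Nat.floor_le (by linarith)
  have hTp : T / 2 < p + 1 := Nat.lt_floor_add_one _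
  have hpn : p ≤ n := by
    have : (p : ℝ) ≤ n := by linarith
    exact_mod_cast this
  obtain ⟨k, rfl⟩ := Nat.exists_eq_add_of_le hpn
  obtain ⟨L', hL'L, hL', hb, hr⟩ := exists_drop h hM1 hLM hL p
  have hr' : (p : ℝ) ≤ rank M (sInf L') := Nat.cast_le.2 hr
  rw [Finset.sum_range_add] at hT
  simp only [hb] at hT
  have hsmall : (∑ i ∈ Finset.range p, if F i then pairing φ (blockSeq first L i) else 0) ≤ p := by
    simpa using Finset.sum_le_sum fun i (_ : i ∈ Finset.range p) => hone i
  obtain ⟨ψ, hψK, -, hψ⟩ := hM.exists_le_sum_mul_pairing h hM1 hδ hδ1 k (hL'L.trans hLM) hL'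
    (fun i => F (p + i)) (fun i => a (p + i)) (fun i hi => ha _ (by omega))
    (fun i hi => hFa _ (by omega)) φ hφK (fun i hi hF => hb i ▸ hφ _ (by omega) hF) (T / 2)
    (by linarith) (by linarith)
  have hp' := hL'L.trans hp
  refine ⟨_, hK.above ψ hψK (sInf L'), ?_⟩
  have h1 : ∀ i < p, pairing (fun m => if sInf L' ≤ m then ψ m else 0) (blockSeq first L i) = 0 :=
    fun i hi => pairing_eq_zero fun m hm => if_neg (not_le.2
      (h.blockSeq_lt i hL hp p hi m hm _ (by
        have := hb 0
        rw [add_zero] at this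
        rw [this]
        exact h.sInf_mem_support hL' hp')))
  have h2 : ∀ i, pairing (fun m => if sInf L' ≤ m then ψ m else 0) (blockSeq first L' i) =
      pairing ψ (blockSeq first L' i) := fun i => pairing_congr fun m hm =>
    if_pos (Nat.sInf_le (h.blockSeq_support_subset hL' hp' i m hm))
  rw [Finset.sum_range_add, Finset.sum_eq_zero fun i hi => by
    rw [h1 i (Finset.mem_range.1 hi), mul_zero], zero_add]
  simp only [hb, h2]
  linarith [err_le_one M (sInf L')]

end IsRemovable

/-! ### The dual unit ball restricted to a sequence -/

section DualBall

variable {X : Type*} [NormedAddCommGroup X] [NormedSpace ℝ X]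

/-- The sequences `(f (x_n))`, where `f` runs over the dual unit ball, described by the inequalities
`|f (μ · x)| ≤ ‖μ · x‖`. -/
def dualBall (x : ℕ → X) : Set (ℕ → ℝ) :=
  {φ | ∀ μ : ℕ →₀ ℝ, |pairing φ μ| ≤ ‖Finsupp.linearCombination ℝ x μ‖}

/-- By Hahn-Banach the inequalities that define `dualBall x` do describe functionals. -/
theorem exists_forall_apply_eq_of_mem_dualBall {x : ℕ → X} {φ : ℕ → ℝ} (hφ : φ ∈ dualBall x) :
    ∃ f : X →L[ℝ] ℝ, ∀ n, f (x n) = φ n := by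
  let T : (ℕ →₀ ℝ) →ₗ[ℝ] X := Finsupp.linearCombination ℝ x
  have hker : LinearMap.ker T ≤ LinearMap.ker (pairing φ) := fun μ hμ => by
    have := hφ μ
    rw [show Finsupp.linearCombination ℝ x μ = 0 from hμ, norm_zero] at this
    exact abs_nonpos_iff.1 this
  let g : LinearMap.range T →ₗ[ℝ] ℝ :=
    (LinearMap.ker T).liftQ (pairing φ) hker ∘ₗ T.quotKerEquivRange.symm.toLinearMap
  have hg : ∀ μ, g ⟨T μ, LinearMap.mem_range_self T μ⟩ = pairing φ μ := fun μ => by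
    have : T.quotKerEquivRange.symm ⟨T μ, LinearMap.mem_range_self T μ⟩ =
        Submodule.Quotient.mk μ := by
      rw [LinearEquiv.symm_apply_eq]
      exact Subtype.ext (T.quotKerEquivRange_apply_mk μ).symm
    simp only [g, LinearMap.comp_apply, LinearEquiv.coe_coe, this]
    exact Submodule.liftQ_apply _ _ _
  have hbound : ∀ y, ‖g y‖ ≤ 1 * ‖y‖ := by
    rintro ⟨_, μ, rfl⟩
    rw [hg, one_mul]
    exact hφ μ
  obtain ⟨f, hf, -⟩ := exists_extension_norm_eq _ (g.mkContinuous 1 hbound)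
  refine ⟨f, fun n => ?_⟩
  have h1 := hf ⟨T (Finsupp.single n 1), LinearMap.mem_range_self T _⟩
  rw [LinearMap.mkContinuous_apply, hg] at h1
  simpa [T] using h1

theorem apply_mem_dualBall (x : ℕ → X) {f : X →L[ℝ] ℝ} (hf : ‖f‖ ≤ 1) :
    (fun n => f (x n)) ∈ dualBall x := fun μ => by
  have h := Finsupp.apply_linearCombination ℝ f.toLinearMap x μ
  have h1 : f (Finsupp.linearCombination ℝ x μ) = pairing (fun n => f (x n)) μ := h
  rw [← h1]
  exact (f.le_of_opNorm_le hf _).trans (one_mul _).le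

theorem neg_mem_dualBall {x : ℕ → X} {φ : ℕ → ℝ} (hφ : φ ∈ dualBall x) :
    (fun n => -φ n) ∈ dualBall x := fun μ => by
  have : pairing (fun n => -φ n) μ = -pairing φ μ := by simp [pairing_eq_sum]
  rw [this, abs_neg]
  exact hφ μ

theorem linearCombination_eq_sum_Icc {x : ℕ → X} (h0 : x 0 = 0) (μ : ℕ →₀ ℝ) {N : ℕ}
    (hN : ∀ n ∈ μ.support, n ≤ N) :
    Finsupp.linearCombination ℝ x μ = ∑ i ∈ Finset.Icc 1 N, μ i • x i := by
  rw [Finsupp.linearCombination_apply, Finsupp.sum_of_support_subset (s := Finset.Icc 0 N) _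
    (fun n hn => Finset.mem_Icc.2 ⟨Nat.zero_le _, hN n hn⟩) _ (by simp)]
  symm
  refine Finset.sum_subset (Finset.Icc_subset_Icc_left (Nat.zero_le 1)) fun i hi hi' => ?_
  obtain rfl : i = 0 := by
    simp only [Finset.mem_Icc] at hi hi'
    omega
  rw [h0, smul_zero]

theorem isDualBall_dualBall {s : ℕ → X} (hs : IsWeaklyNull s) (h0 : s 0 = 0) :
    IsDualBall (dualBall s) := by
  have hone : ∀ φ ∈ dualBall s, ∀ n, |φ n| ≤ 1 := fun φ hφ n => by
    have h := hφ (Finsupp.single n 1)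
    simp only [Finsupp.linearCombination_single, one_smul] at h
    rcases Nat.eq_zero_or_pos n with rfl | hn
    · exact h.trans (by simp [h0])
    · exact h.trans (hs.normalized n hn).le
  have hbi : ∀ (μ : ℕ →₀ ℝ) (r : ℕ),
      ‖Finsupp.linearCombination ℝ s (μ.filter (· < r))‖ ≤ ‖Finsupp.linearCombination ℝ s μ‖ ∧
      ‖Finsupp.linearCombination ℝ s (μ.filter (r ≤ ·))‖ ≤ ‖Finsupp.linearCombination ℝ s μ‖ := by
    intro μ r
    let N := max (μ.support.sup id) r
    have hN : ∀ n ∈ μ.support, n ≤ N := fun n hn =>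
      (Finset.le_sup (f := id) hn).trans (le_max_left _ _)
    have hfilter : ∀ (p : ℕ → Prop) [DecidablePred p], ∀ n ∈ (μ.filter p).support, n ≤ N :=
      fun p _ n hn => hN n (Finset.mem_of_mem_filter n (Finsupp.support_filter p μ ▸ hn))
    have h := hs.bimonotone μ (r - 1) N ((Nat.sub_le r 1).trans (le_max_right _ _))
    rw [linearCombination_eq_sum_Icc h0 μ hN, linearCombination_eq_sum_Icc h0 _ (hfilter (· < r)),
      linearCombination_eq_sum_Icc h0 _ (hfilter (r ≤ ·))]
    simp only [Finsupp.filter_apply, ite_smul, zero_smul, ← Finset.sum_filter]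
    have e1 : (Finset.Icc 1 N).filter (· < r) = Finset.Icc 1 (r - 1) := by
      ext i
      have : r ≤ N := le_max_right _ _
      simp only [Finset.mem_filter, Finset.mem_Icc]
      omega
    have e2 : (Finset.Icc 1 N).filter (r ≤ ·) = Finset.Icc (r - 1 + 1) N := by
      ext i
      simp only [Finset.mem_filter, Finset.mem_Icc]
      omega
    rw [e1, e2]
    exact max_le_iff.1 h
  have hcut : ∀ (φ : ℕ → ℝ) (p : ℕ → Prop) [DecidablePred p] (μ : ℕ →₀ ℝ),
      pairing (fun n => if p n then φ n else 0) μ = pairing φ (μ.filter p) := by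
    intro φ p _ μ
    rw [pairing_eq_sum, pairing_eq_sum, Finsupp.support_filter, Finset.sum_filter]
    refine Finset.sum_congr rfl fun n _ => ?_
    by_cases hp : p n <;> simp [hp]
  refine ⟨?_, hone, fun φ hφ r μ => ?_, fun φ hφ r μ => ?_, fun φ hφ => ?_⟩
  · refine (isCompact_univ_pi fun _ : ℕ => isCompact_Icc (a := (-1 : ℝ)) (b := 1)).of_isClosed_subset
      ?_ fun φ hφ n _ => abs_le.1 (hone φ hφ n)
    simp only [dualBall, ofPred_forall]
    refine isClosed_iInter fun μ => isClosed_le ?_ continuous_const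
    simp only [pairing_eq_sum]
    exact (continuous_finsetSum _ fun n _ => continuous_const.mul (continuous_apply n)).abs
  · rw [hcut φ (· < r)]
    exact (hφ _).trans (hbi μ r).1
  · rw [hcut φ (r ≤ ·)]
    exact (hφ _).trans (hbi μ r).2
  · obtain ⟨f, hf⟩ := exists_forall_apply_eq_of_mem_dualBall hφ
    simpa [hf] using hs.weakly_null f

end DualBall

/-! ### Near unconditionality -/

/-- Generalized Elton near unconditionality; the block sequences are numbered from `0`, so that
`repeatedAverage A ξ L i` is the `(i+1)`-st repeated average of order `ξ` of `L`. -/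
theorem theoremT {X : Type*} [NormedAddCommGroup X] [NormedSpace ℝ X] [CompleteSpace X]
    (A : AssociatedSequences) (s : ℕ → X) (hs : IsWeaklyNull s)
    (ξ : Ordinal.{0}) (hξ : ξ < Ordinal.omega 1) :
    ∃ M : Set ℕ, M ⊆ Set.Ici 1 ∧ M.Infinite ∧
      ∀ δ : ℝ, 0 < δ → δ ≤ 1 → ∃ C : ℝ, 0 < C ∧
        ∀ L : Set ℕ, L ⊆ M → L.Infinite →
        ∀ (n : ℕ) (a : ℕ → ℝ), (∀ i < n, a i ∈ Set.Icc (-1 : ℝ) 1) →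
        ∀ F : Finset ℕ, (∀ i ∈ F, i < n ∧ δ ≤ |a i|) →
          ‖∑ i ∈ F, a i • dotSeq (repeatedAverage A ξ L i) s‖ ≤
            C * max δ ‖∑ i ∈ Finset.range n, a i • dotSeq (repeatedAverage A ξ L i) s‖ := by
  classical
  obtain ⟨first, h, hfirst⟩ := exists_isAveraging_repeatedAverage A ξ hξ
  -- The value `s 0` is free; it is replaced by `0`.
  let x : ℕ → X := Function.update s 0 0
  have hxs : ∀ i, 1 ≤ i → x i = s i := fun i hi =>
    Function.update_of_ne (Nat.one_le_iff_ne_zero.1 hi) _ _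
  have hx0 : x 0 = 0 := Function.update_self _ _ _
  have hx : IsWeaklyNull x := by
    refine ⟨fun f => (hs.weakly_null f).congr' ?_, fun n hn => hxs n hn ▸ hs.normalized n hn,
      fun a n N hn => ?_⟩
    · exact (eventually_ge_atTop 1).mono fun n hn => by simp only [hxs n hn]
    · have : ∀ k N, 1 ≤ k → ∑ i ∈ Finset.Icc k N, a i • x i = ∑ i ∈ Finset.Icc k N, a i • s i :=
        fun k N hk => Finset.sum_congr rfl fun i hi => by
          rw [hxs i (hk.trans (Finset.mem_Icc.1 hi).1)]
      rw [this _ _ le_rfl, this _ _ le_rfl, this _ _ (Nat.le_add_left 1 n)]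
      exact hs.bimonotone a n N hn
  have hK := isDualBall_dualBall hx hx0
  obtain ⟨M, hM1, hM, hrem⟩ := hK.exists_isRemovable h
  refine ⟨M, hM1, hM, fun δ hδ hδ1 => ⟨4 / δ * (1 + 12 / δ), by positivity,
    fun L hLM hL n a ha F hF => ?_⟩⟩
  have hp : L ⊆ Ici 1 := hLM.trans hM1
  have hdot : ∀ i, dotSeq (repeatedAverage A ξ L i) s =
      Finsupp.linearCombination ℝ x (blockSeq first L i) := fun i => by
    rw [hfirst L hL hp, dotSeq, Finsupp.linearCombination_apply]
    exact Finset.sum_congr rfl fun m hm => by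
      simp only [hxs m (hp (h.blockSeq_support_subset hL hp i m hm))]
  simp only [hdot]
  set U := ‖∑ i ∈ Finset.range n, a i • Finsupp.linearCombination ℝ x (blockSeq first L i)‖
  have hU : ∀ ψ ∈ dualBall x, |∑ i ∈ Finset.range n, a i * pairing ψ (blockSeq first L i)| ≤ U := by
    intro ψ hψ
    have := hψ (∑ i ∈ Finset.range n, a i • blockSeq first L i)
    simpa only [map_sum, map_smul, smul_eq_mul] using this
  have habs : ∀ i < n, |a i| ≤ 1 := fun i hi => abs_le.2 (ha i hi)
  -- The blocks in `F` where `φ` is nonnegative and the coefficients have the sign `σ`. It is applied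
  -- to `σ = 1` and a norming functional, and to `σ = -1` and the negative of that functional.
  have key : ∀ σ : ℝ, |σ| = 1 → ∀ φ ∈ dualBall x,
      (∑ i ∈ Finset.range n, if i ∈ F ∧ 0 ≤ σ * a i ∧ 0 ≤ pairing φ (blockSeq first L i) then
        pairing φ (blockSeq first L i) else 0) ≤ 2 / δ * (U + 12) := by
    intro σ hσ φ hφ
    obtain ⟨ψ, hψ, hle⟩ := hrem.exists_half_le_sum_mul_pairing hK h hM1 hδ hδ1 n hLM hL
      (fun i => i ∈ F ∧ 0 ≤ σ * a i ∧ 0 ≤ pairing φ (blockSeq first L i)) (fun i => σ * a i)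
      (fun i hi => by rw [abs_mul, hσ, one_mul]; exact habs i hi)
      (fun i hi hFi => by
        rw [← abs_of_nonneg hFi.2.1, abs_mul, hσ, one_mul]
        exact (hF i hFi.1).2) φ hφ (fun i hi hFi => hFi.2.2)
    have h1 : ∑ i ∈ Finset.range n, σ * a i * pairing ψ (blockSeq first L i) ≤ U := by
      simp only [mul_assoc, ← Finset.mul_sum]
      refine (le_abs_self _).trans ?_
      rw [abs_mul, hσ, one_mul]
      exact hU ψ hψ
    rw [div_mul_eq_mul_div, le_div_iff₀ hδ]
    linarith
  obtain ⟨f, hf1, hf⟩ := exists_dual_vector'' ℝ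
    (∑ i ∈ F, a i • Finsupp.linearCombination ℝ x (blockSeq first L i))
  have hφ := apply_mem_dualBall x hf1
  set φ : ℕ → ℝ := fun n => f (x n)
  have hfφ : ∀ μ, f (Finsupp.linearCombination ℝ x μ) = pairing φ μ :=
    fun μ => Finsupp.apply_linearCombination ℝ f.toLinearMap x μ
  have hpos := key 1 (by simp) φ hφ
  have hneg := key (-1) (by simp) _ (neg_mem_dualBall hφ)
  have hsplit : ‖∑ i ∈ F, a i • Finsupp.linearCombination ℝ x (blockSeq first L i)‖ ≤
      2 / δ * (U + 12) + 2 / δ * (U + 12) := by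
    refine le_trans ?_ (add_le_add hpos hneg)
    rw [← Finset.sum_add_distrib]
    have hnorm : ‖∑ i ∈ F, a i • Finsupp.linearCombination ℝ x (blockSeq first L i)‖ =
        ∑ i ∈ F, a i * pairing φ (blockSeq first L i) := by
      have : f (∑ i ∈ F, a i • Finsupp.linearCombination ℝ x (blockSeq first L i)) =
          ‖∑ i ∈ F, a i • Finsupp.linearCombination ℝ x (blockSeq first L i)‖ := hf
      rw [← this, map_sum]
      simp only [map_smul, smul_eq_mul, hfφ]
    have hFn : F ⊆ Finset.range n := fun i hi => Finset.mem_range.2 (hF i hi).1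
    rw [hnorm]
    have hnegp : ∀ μ, pairing (fun n => -φ n) μ = -pairing φ μ := fun μ => by
      simp [pairing_eq_sum]
    simp only [hnegp]
    refine (Finset.sum_le_sum fun i hi => ?_).trans
      (Finset.sum_le_sum_of_subset_of_nonneg hFn fun i _ _ => ?_)
    · have hai := habs i (hF i hi).1
      generalize pairing φ (blockSeq first L i) = v
      rw [abs_le] at hai
      simp only [hi, true_and, one_mul, neg_mul, Left.nonneg_neg_iff]
      rcases le_total 0 (a i) with h1 | h1 <;> rcases le_total 0 v with h2 | h2 <;>
        split_ifs <;> first | nlinarith | tauto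
    · refine add_nonneg ?_ ?_
      · split_ifs with hc
        · exact hc.2.2
        · exact le_rfl
      · split_ifs with hc
        · exact hc.2.2
        · exact le_rfl
  refine hsplit.trans ?_
  have h1 : U ≤ max δ U := le_max_right _ _
  have h2 : 12 ≤ 12 / δ * max δ U := by
    rw [div_mul_eq_mul_div, le_div_iff₀ hδ]
    exact mul_le_mul_of_nonneg_left (le_max_left _ _) (by norm_num)
  calc 2 / δ * (U + 12) + 2 / δ * (U + 12) = 4 / δ * (U + 12) := by ring
    _ ≤ 4 / δ * (max δ U + 12 / δ * max δ U) :=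
        mul_le_mul_of_nonneg_left (add_le_add h1 h2) (by positivity)
    _ = 4 / δ * (1 + 12 / δ) * max δ U := by ring
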